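/- Let $M=\{(x,y)\in\mathbb R^2 : 1\le x^2+y^2\le 25\}$. A diffeomorphism $A$ of $M$ is called analytic if $A$ and $A^{-1}$ are real analytic on $M$ up to the boundary (i.e. extend analytically to a neighbourhood of $M$), and it has the intersection property if $A(K)\cap K\neq\varnothing$ for every simple closed curve $K\subset M$ that is homotopic in $M$ to the circle $\{x^2+y^2=9\}$. A set lies strictly inside (outside) a closed curve $K$ if it is disjoint from $K$ and contained in the bounded (unbounded) components of $\mathbb R^2\setminus K$. For $1\le\rho\le5$ and $\vartheta\in\mathbb R$ put $$x=\chi(\rho)\cos\vartheta,\quad y=\eta(\rho)\sin\vartheta,\qquad \chi(\rho)=\frac{7\rho-5}{\rho+1},\quad \eta(\rho)=\frac{\rho+5}{7-\rho},$$ and let $P(\rho)=(\rho-1)(\rho-3)^2(\rho-5)$. Let $R(x,y)=(-y,x)$ be the rotation of $M$ by $\pi/2$ and $\gamma=\{x^2/4+y^2/16=1\}\subset M$. Then: 1. $(\rho,\vartheta \bmod 2\pi)$ are analytic coordinates on $M$: every point of $M$ is given by exactly one pair $(\rho,\vartheta)\in[1,5]\times[0,2\pi)$, all pairs in this set give points of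 $M$, and the analytic map $(\rho,\vartheta)\mapsto(x,y)$ has invertible derivative at all points with $1\le\rho\le5$. 2. $R$ is an analytic diffeomorphism of $M$ with the intersection property, and $R\gamma=\{x^2/16+y^2/4=1\}=\{\rho=3\}$. 3. For all $0<\varepsilon_1<1/16$ and $0<\varepsilon_2<1/2$ there is exactly one bijection $G$ of $M$ given in these coordinates by $G(\rho,\vartheta)=(\rho+\varepsilon_1P(\rho),\ \vartheta+\varepsilon_2\sin2\vartheta)$. Both $G$ and $S=GRG^{-1}$ are analytic diffeomorphisms of $M$, and $S$ has the intersection property, but the composition $RS$ does not. More precisely, let $\delta=G\gamma$. Then $R\gamma$ and $\delta$ are simple closed curves homotopic in $M$ to $\{x^2+y^2=9\}$, $G(R\gamma)=R\gamma$, $\delta$ lies strictly inside $\gamma$, $S(R\gamma)=\delta$ and $S\delta=R\gamma$; the composition $RS$ takes $R\gamma$ to $R\delta$, which lies strictly inside $R\gamma$, and takes $\delta$ to $\gamma$, which lies strictly outside $\delta$. 4. $S$ can be taken arbitrarily close to $R$ in the $C^\infty$ topology: for every integer $k\ge0$ and every $r>0$ there is $\varepsilon_0>0$ such that, whenever $0<\varepsilon_1<\min(\varepsilon_0,1/16)$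 and $0<\varepsilon_2<\min(\varepsilon_0,1/2)$, all derivatives of orders $0,\dots,k$ of $S-R$, and likewise of $G-\mathrm{id}$, have norm less than $r$ on $M$. -/

import Mathlib

namespace AnnulusExample

/-- The closed annulus `M = {1 ≤ x² + y² ≤ 25}` in the plane. -/
def annulus : Set (ℝ × ℝ) :=
  {p | 1 ≤ p.1 ^ 2 + p.2 ^ 2 ∧ p.1 ^ 2 + p.2 ^ 2 ≤ 25}

/-- The rotation `(x, y) ↦ (-y, x)` by `π / 2`, as a bijection of the annulus. -/
def rotation : Equiv.Perm annulus where
  toFun p := ⟨(-(p : ℝ × ℝ).2, (p : ℝ × ℝ).1), by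
    obtain ⟨⟨x, y⟩, h1, h2⟩ := p
    refine ⟨?_, ?_⟩ <;> simp only at * <;> nlinarith⟩
  invFun p := ⟨((p : ℝ × ℝ).2, -(p : ℝ × ℝ).1), by
    obtain ⟨⟨x, y⟩, h1, h2⟩ := p
    refine ⟨?_, ?_⟩ <;> simp only at * <;> nlinarith⟩
  left_inv p := by simp
  right_inv p := by simp

/-! ### Analytic diffeomorphisms of the annulus and closeness -/

/-- `F` is an extension of the self-map `f` of the annulus that is real analytic at every point
of the annulus (boundary included), hence in an open neighbourhood of it. -/
def IsAnalyticExtension (F : ℝ × ℝ → ℝ × ℝ) (f : annulus → annulus) : Prop :=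
  AnalyticOnNhd ℝ F annulus ∧ ∀ p : annulus, F p = f p

/-- A bijection of the annulus which is analytic together with its inverse. -/
def IsAnalyticDiffeo (A : Equiv.Perm annulus) : Prop :=
  (∃ F, IsAnalyticExtension F A) ∧ ∃ F, IsAnalyticExtension F A.symm

/-- `f` and `g` are `δ`-close in the `C^k` topology: all derivatives of `f - g` of orders `0, …, k`
are smaller than `δ` on the annulus. (At points of the annulus, which is the closure of its
interior, the derivatives do not depend on the choice of the analytic extensions.) -/
def CkClose (k : ℕ) (δ : ℝ) (f g : annulus → annulus) : Prop :=
  ∃ F H : ℝ × ℝ → ℝ × ℝ, IsAnalyticExtension F f ∧ IsAnalyticExtension H g ∧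
    ∀ j ≤ k, ∀ p ∈ annulus, ‖iteratedFDeriv ℝ j (fun q => F q - H q) p‖ < δ

/-! ### The intersection property -/

/-- The circle `x² + y² = 9` in the annulus, with its standard parametrization. -/
def coreCircle : C(Circle, annulus) where
  toFun z := ⟨(3 * (z : ℂ).re, 3 * (z : ℂ).im), by
    have h : (z : ℂ).re ^ 2 + (z : ℂ).im ^ 2 = 1 := by
      have h := Circle.normSq_coe z
      rw [Complex.normSq_apply] at h
      nlinarith
    refine ⟨?_, ?_⟩ <;> simp only <;> nlinarith⟩
  continuous_toFun := by
    refine Continuous.subtype_mk ?_ _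
    exact (continuous_const.mul (Complex.continuous_re.comp continuous_subtype_val)).prodMk
      (continuous_const.mul (Complex.continuous_im.comp continuous_subtype_val))

/-- `K` is a simple closed curve in the annulus which is (freely) homotopic, within the annulus,
to a concentric circle. -/
def IsEssentialCurve (K : Set annulus) : Prop :=
  ∃ c : C(Circle, annulus),
    Function.Injective c ∧ c.Homotopic coreCircle ∧ Set.range c = K

/-- Every simple closed curve homotopic to a concentric circle meets its image. -/
def HasIntersectionProperty (A : annulus → annulus) : Prop :=
  ∀ K : Set annulus, IsEssentialCurve K → (A '' K ∩ K).Nonempty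

/-! ### Position with respect to a closed curve -/

/-- `C` lies strictly inside `K`: it is disjoint from `K` and contained in the union of the bounded
components of the complement of `K` in the plane. -/
def StrictlyInside (C K : Set annulus) : Prop :=
  ∀ p ∈ C, p ∉ K ∧
    Bornology.IsBounded (connectedComponentIn ((Subtype.val '' K)ᶜ : Set (ℝ × ℝ)) (p : ℝ × ℝ))

/-- `C` lies strictly outside `K`: it is disjoint from `K` and contained in the union of the
unbounded components of the complement of `K` in the plane. -/
def StrictlyOutside (C K : Set annulus) : Prop :=
  ∀ p ∈ C, p ∉ K ∧
    ¬ Bornology.IsBounded (connectedComponentIn ((Subtype.val '' K)ᶜ : Set (ℝ × ℝ)) (p : ℝ × ℝ))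

/-! ### The special elliptic coordinates -/

noncomputable def chi (ρ : ℝ) : ℝ := (7 * ρ - 5) / (ρ + 1)

noncomputable def eta (ρ : ℝ) : ℝ := (ρ + 5) / (7 - ρ)

/-- The point with elliptic coordinates `(ρ, ϑ)`; only `1 ≤ ρ ≤ 5` is used. -/
noncomputable def ellipticPoint (q : ℝ × ℝ) : ℝ × ℝ :=
  (chi q.1 * Real.cos q.2, eta q.1 * Real.sin q.2)

def P (ρ : ℝ) : ℝ := (ρ - 1) * (ρ - 3) ^ 2 * (ρ - 5)

/-- `G` is the map `(ρ, ϑ) ↦ (ρ + ε₁ P(ρ), ϑ + ε₂ sin 2ϑ)` of the annulus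
in elliptic coordinates. -/
def IsEllipticShift (ε₁ ε₂ : ℝ) (G : Equiv.Perm annulus) : Prop :=
  ∀ (p : annulus) (ρ ϑ : ℝ), ρ ∈ Set.Icc (1 : ℝ) 5 → (p : ℝ × ℝ) = ellipticPoint (ρ, ϑ) →
    (G p : ℝ × ℝ) = ellipticPoint (ρ + ε₁ * P ρ, ϑ + ε₂ * Real.sin (2 * ϑ))

/-- The ellipse `x² / 4 + y² / 16 = 1`. -/
def ellipse : Set annulus :=
  {p | (p : ℝ × ℝ).1 ^ 2 / 4 + (p : ℝ × ℝ).2 ^ 2 / 16 = 1}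

end AnnulusExample

namespace AnnulusExample

/-! The failure for `R S` is algebraic. `G` maps the curve `Rγ = {ρ = 3}` to itself, because `P 3 =
0`, and `R²γ = γ` by symmetry. So `S(Rγ) = G R (G⁻¹ Rγ) = G R²γ = Gγ = δ`, and `R S` sends `Rγ` to
`Rδ`. It is enough that `δ` lies strictly inside `γ`, which is `shift_gauge_lt`. There the radial
part of `G` lowers `ρ` except at `ρ = 1, 3, 5`, and the angular part lowers `cos² ϑ` except on the
axes. Both effects lower the gauge of `γ`, and no point of `γ` escapes both: `ρ = 1, 5` do not occur
on `γ`, and where `γ` meets `ρ = 3` it is off the axes.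

The intersection property of `R` is topological. If `RK` missed `K`, the order four of `R` would
force `RK` into the component of `Kᶜ` at `0` and also into the one far outside
(`rotation_image_subset_component`). An essential `K` separates these two
(`far_notMem_connectedComponentIn`): seen from `0` the curve has no continuous logarithm, seen from
far away it has one. The property passes to `S` because `G⁻¹` preserves essential curves.

`shiftMap` and `unshiftMap` are analytic jointly in the parameters and the point. This single fact
gives the analytic diffeomorphisms, the isotopy of `G` to the identity along `t • ε`, and, by
compactness of the annulus, the `C^k` closeness. -/

section

open Filter Topology
open scoped ContDiff

/-! ### Analytic implicit functions and derivatives of analytic families. -/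

/-- A function given by the locally unique roots of an analytic equation with nonvanishing
derivative in the unknown is analytic. -/
theorem analyticAt_of_implicit {E : Type*} [NormedAddCommGroup E] [NormedSpace ℝ E]
    [CompleteSpace E] {g : E × ℝ → ℝ} {φ : E → ℝ} {e : E} {t g' : ℝ}
    (hg : AnalyticAt ℝ g (e, t)) (hd : HasDerivAt (fun s => g (e, s)) g' t) (hg' : g' ≠ 0)
    (h0 : g (e, t) = 0) (hu : ∀ᶠ z in 𝓝 (e, t), g z = 0 → φ z.1 = z.2) :
    AnalyticAt ℝ φ e := by
  have cdf : ContDiffAt ℝ ω g (e, t) := hg.contDiffAt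
  have hfd : HasFDerivAt (fun s => g (e, s))
      (fderiv ℝ g (e, t) ∘L .inr ℝ E ℝ) t := by
    have h1 : HasFDerivAt g (fderiv ℝ g (e, t)) (e, t) := hg.differentiableAt.hasFDerivAt
    exact h1.comp t (hasFDerivAt_prodMk_right e t)
  have heq : (fderiv ℝ g (e, t) ∘L .inr ℝ E ℝ) 1 = g' := by
    have := hfd.hasDerivAt.unique hd
    exact this
  have hinv : (fderiv ℝ g (e, t) ∘L .inr ℝ E ℝ).IsInvertible := by
    refine ⟨ContinuousLinearEquiv.unitsEquivAut ℝ (Units.mk0 g' hg'), ?_⟩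
    ext
    rw [heq]
    simp
  have hne : (ω : ℕ∞ω) ≠ 0 := by simp
  have hψ : AnalyticAt ℝ (cdf.implicitFunction hne hinv) e :=
    (cdf.contDiffAt_implicitFunction hne hinv).analyticAt
  have happ := cdf.eventually_apply_implicitFunction hne hinv
  -- The uniqueness hypothesis is pulled back along the graph of the implicit function, which passes
  -- through `(e, t)`; it then identifies `φ` with that function near `e`.
  have hcont : ContinuousAt (fun x => (x, cdf.implicitFunction hne hinv x)) e :=
    continuousAt_id.prodMk hψ.continuousAt
  have hself : cdf.implicitFunction hne hinv e = t := cdf.implicitFunction_apply_self hne hinv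
  have hu' : ∀ᶠ x in 𝓝 e, g (x, cdf.implicitFunction hne hinv x) = 0 →
      φ x = cdf.implicitFunction hne hinv x := by
    have : Tendsto (fun x => (x, cdf.implicitFunction hne hinv x)) (𝓝 e) (𝓝 (e, t)) := by
      have := hcont.tendsto
      rwa [hself] at this
    exact this.eventually hu
  refine hψ.congr ?_
  filter_upwards [happ, hu'] with x h1 h2
  exact (h2 (h1.trans h0)).symm

/-- Analyticity at a point persists on an open neighbourhood, where the chain rule for derivatives
within a set applies; on open sets these are the ordinary derivatives. -/
theorem iteratedFDeriv_comp_right_of_analyticAt {E F G : Type*} [NormedAddCommGroup E]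
    [NormedSpace ℝ E] [NormedAddCommGroup F] [NormedSpace ℝ F] [CompleteSpace F]
    [NormedAddCommGroup G] [NormedSpace ℝ G] (g : G →L[ℝ] E) {f : E → F} {x : G}
    (hf : AnalyticAt ℝ f (g x)) (i : ℕ) :
    iteratedFDeriv ℝ i (f ∘ g) x =
      (iteratedFDeriv ℝ i f (g x)).compContinuousLinearMap fun _ => g := by
  obtain ⟨s, hs, hso, hxs⟩ := eventually_nhds_iff.1 hf.eventually_analyticAt
  have hcd : ContDiffOn ℝ i f s := fun y hy => (hs y hy).contDiffAt.contDiffWithinAt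
  have hpre : IsOpen (g ⁻¹' s) := hso.preimage g.continuous
  have := g.iteratedFDerivWithin_comp_right hcd hso.uniqueDiffOn hpre.uniqueDiffOn hxs le_rfl
  rwa [iteratedFDerivWithin_of_isOpen i hpre hxs, iteratedFDerivWithin_of_isOpen i hso hxs] at this

/-- The slice embedding `q ↦ (ε, q)` is the linear map `inr` followed by translation by `(ε, 0)`,
and translation commutes with differentiation. -/
theorem iteratedFDeriv_slice {E F Q : Type*} [NormedAddCommGroup E]
    [NormedSpace ℝ E] [NormedAddCommGroup F] [NormedSpace ℝ F] [CompleteSpace F]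
    [NormedAddCommGroup Q] [NormedSpace ℝ Q] {D : Q × E → F} {ε : Q} {p : E}
    (hD : AnalyticAt ℝ D (ε, p)) (i : ℕ) :
    iteratedFDeriv ℝ i (fun q => D (ε, q)) p =
      (iteratedFDeriv ℝ i D (ε, p)).compContinuousLinearMap
        fun _ => ContinuousLinearMap.inr ℝ Q E := by
  have h1 : AnalyticAt ℝ (fun z => D ((ε, 0) + z)) (ContinuousLinearMap.inr ℝ Q E p) := by
    refine AnalyticAt.fun_comp (f := fun z => ((ε, 0) : Q × E) + z) ?_ (by fun_prop)
    simpa using hD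
  have h2 := iteratedFDeriv_comp_right_of_analyticAt (ContinuousLinearMap.inr ℝ Q E) h1 i
  rw [iteratedFDeriv_comp_add_left] at h2
  simpa [Function.comp_def] using h2

/-- In a jointly analytic family the derivatives of the members depend continuously on the
parameter, uniformly on compact sets. -/
theorem eventually_iteratedFDeriv_slice_sub_lt {E F Q : Type*} [NormedAddCommGroup E]
    [NormedSpace ℝ E] [NormedAddCommGroup F] [NormedSpace ℝ F] [CompleteSpace F]
    [NormedAddCommGroup Q] [NormedSpace ℝ Q] {J : Q × E → F} {K : Set E} (hK : IsCompact K)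
    (hJ : ∀ p ∈ K, AnalyticAt ℝ J (0, p)) (k : ℕ) {r : ℝ} (hr : 0 < r) :
    ∀ᶠ ε in 𝓝 (0 : Q), ∀ j ≤ k, ∀ p ∈ K,
      ‖iteratedFDeriv ℝ j (fun q => J (ε, q) - J (0, q)) p‖ < r := by
  have key : ∀ j, ∀ᶠ ε in 𝓝 (0 : Q), ∀ p ∈ K,
      ‖iteratedFDeriv ℝ j (fun q => J (ε, q) - J (0, q)) p‖ < r := by
    intro j
    refine hK.eventually_forall_of_forall_eventually fun p hp => ?_
    -- Subtracting the member at parameter `0` makes the slice derivatives vanish at `(0, p)`; joint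
    -- continuity keeps them small nearby, and compactness of `K` makes this uniform.
    set D : Q × E → F := fun z => J z - J (0, z.2) with hDdef
    have hD : AnalyticAt ℝ D (0, p) := by
      refine (hJ p hp).sub ?_
      exact AnalyticAt.fun_comp (g := J) (f := fun z : Q × E => ((0 : Q), z.2)) (hJ p hp)
        (analyticAt_const.prod analyticAt_snd)
    have hc : ContinuousAt (fun z : Q × E => (iteratedFDeriv ℝ j D z).compContinuousLinearMap
        fun _ => ContinuousLinearMap.inr ℝ Q E) (0, p) :=
      (ContinuousMultilinearMap.compContinuousLinearMapL (F := F)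
        fun _ : Fin j => ContinuousLinearMap.inr ℝ Q E).continuous.continuousAt.comp
        (hD.contDiffAt.iteratedFDeriv_right (m := 0) (n := ω) (by simp)).continuousAt
    have h0 : (iteratedFDeriv ℝ j D (0, p)).compContinuousLinearMap
        (fun _ => ContinuousLinearMap.inr ℝ Q E) = 0 := by
      rw [← iteratedFDeriv_slice hD j]
      simp only [hDdef, sub_self]
      exact congrFun (iteratedFDeriv_fun_zero (𝕜 := ℝ) (n := j)) p
    have hlt := hc.norm.eventually_lt_const (u := r) (by
      simpa only [h0, norm_zero] using hr)
    filter_upwards [hlt, hD.eventually_analyticAt] with z hz hz'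
    have := iteratedFDeriv_slice (ε := z.1) (p := z.2) hz' j
    simp only [hDdef] at this hz
    rw [this]
    exact hz
  have := (Set.finite_Iic k).eventually_all (l := 𝓝 (0 : Q)) |>.2 fun j _ => key j
  filter_upwards [this] with ε h j hj
  exact h j hj

/-! ### Continuous logarithms and separation of the plane by essential curves. -/

/-- The map `f` on the circle has a continuous logarithm. -/
def HasLog (f : C(Circle, ℂ)) : Prop :=
  ∃ g : C(Circle, ℂ), ∀ z, Complex.exp (g z) = f z

/-- The quotient `f / h` stays in the unit disc about `1`, hence in the slit plane, so its principal
logarithm is continuous and can be added to the logarithm of `h`. -/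
theorem HasLog.of_norm_sub_lt {f h : C(Circle, ℂ)} (hh : HasLog h)
    (hlt : ∀ z, ‖f z - h z‖ < ‖h z‖) : HasLog f := by
  obtain ⟨g, hg⟩ := hh
  have hne : ∀ z, h z ≠ 0 := fun z => by rw [← hg]; exact Complex.exp_ne_zero _
  have hslit : ∀ z, f z / h z ∈ Complex.slitPlane := by
    intro z
    have h1 : ‖(f z - h z) / h z‖ < 1 := by
      rw [norm_div, div_lt_one (norm_pos_iff.2 (hne z))]
      exact hlt z
    have h2 := Complex.mem_slitPlane_of_norm_lt_one h1
    have h3 : 1 + (f z - h z) / h z = f z / h z := by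
      field_simp [hne z]
      ring
    rwa [h3] at h2
  refine ⟨⟨fun z => g z + Complex.log (f z / h z), ?_⟩, fun z => ?_⟩
  · exact g.continuous.add ((f.continuous.div h.continuous hne).clog hslit)
  · have : f z / h z ≠ 0 := Complex.slitPlane_ne_zero (hslit z)
    simp only [ContinuousMap.coe_mk, Complex.exp_add, hg, Complex.exp_log this]
    field_simp [hne z]

/-- The existence of a continuous logarithm is constant on connected sets of nonvanishing maps. -/
theorem HasLog.of_isPreconnected {T : Set C(Circle, ℂ)} (hT : IsPreconnected T)
    (h0 : ∀ f ∈ T, ∀ z, f z ≠ 0) {f h : C(Circle, ℂ)} (hf : f ∈ T) (hh : h ∈ T)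
    (hlog : HasLog f) : HasLog h := by
  refine hT.induction₂' (fun a b => HasLog a → HasLog b) (fun a ha => ?_)
    (fun x y z hx hy hz h1 h2 h3 => h2 (h1 h3)) hf hh hlog
  -- Within half the minimum modulus of `a`, the comparison `HasLog.of_norm_sub_lt` works in both
  -- directions.
  obtain ⟨z₀, -, hz₀⟩ := isCompact_univ.exists_isMinOn Set.univ_nonempty
    a.continuous.norm.continuousOn
  have hm : 0 < ‖a z₀‖ := norm_pos_iff.2 (h0 a ha z₀)
  have hmin : ∀ z, ‖a z₀‖ ≤ ‖a z‖ := fun z => hz₀ (Set.mem_univ z)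
  refine eventually_nhdsWithin_of_eventually_nhds ?_
  filter_upwards [Metric.ball_mem_nhds a (half_pos hm)] with b hb
  have hd : ∀ z, ‖b z - a z‖ < ‖a z₀‖ / 2 := fun z => by
    rw [← dist_eq_norm]
    exact (ContinuousMap.dist_apply_le_dist z).trans_lt hb
  refine ⟨fun hl => hl.of_norm_sub_lt fun z => ?_, fun hl => hl.of_norm_sub_lt fun z => ?_⟩
  · linarith [hd z, hmin z]
  · have h1 := hd z
    have h2 := norm_sub_norm_le (a z) (b z)
    rw [norm_sub_rev] at h1
    rw [norm_sub_rev]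
    linarith [hmin z, norm_sub_rev (a z) (b z)]

/-- Along `z = exp(it)` a logarithm minus `it + log r` takes values in `2πiℤ`, yet its imaginary
part drops by `2π` over one turn; continuity forbids this. -/
theorem not_hasLog_of_eq_mul {f : C(Circle, ℂ)} {r : ℝ} (hr : 0 < r)
    (hf : ∀ z : Circle, f z = r * z) : ¬ HasLog f := by
  rintro ⟨g, hg⟩
  set k : ℝ → ℂ := fun t => g (Circle.exp t) - t * Complex.I - Complex.log r with hk
  have hr' : (r : ℂ) ≠ 0 := by exact_mod_cast hr.ne'
  have hk1 : ∀ t, Complex.exp (k t) = 1 := by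
    intro t
    simp only [hk, Complex.exp_sub, hg, hf, Circle.coe_exp, Complex.exp_log hr']
    field_simp [Complex.exp_ne_zero]
  have hkc : Continuous fun t => (k t).im := by
    refine Complex.continuous_im.comp ?_
    have : Continuous fun t => g (Circle.exp t) := g.continuous.comp Circle.exp.continuous
    fun_prop
  have hend : (k (2 * Real.pi)).im = (k 0).im - 2 * Real.pi := by
    simp [hk, Circle.exp_two_pi]
    ring
  have hivt := intermediate_value_uIcc (a := 0) (b := 2 * Real.pi) hkc.continuousOn
  have hpi := Real.pi_pos
  -- The value halfway between the two ends is not congruent to them modulo `2π`.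
  obtain ⟨t, -, ht⟩ : (k 0).im - Real.pi ∈
      (fun t => (k t).im) '' Set.uIcc 0 (2 * Real.pi) := by
    apply hivt
    rw [hend, Set.mem_uIcc]
    right
    constructor <;> linarith
  have hint : ∀ s, ∃ n : ℤ, (k s).im = n * (2 * Real.pi) := by
    intro s
    obtain ⟨n, hn⟩ := Complex.exp_eq_one_iff.1 (hk1 s)
    exact ⟨n, by rw [hn]; simp⟩
  obtain ⟨n, hn⟩ := hint t
  obtain ⟨m, hm⟩ := hint 0
  simp only [hn, hm] at ht
  have h2 : (n : ℝ) * 2 = m * 2 - 1 := by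
    have : ((n : ℝ) * 2 - (m * 2 - 1)) * Real.pi = 0 := by linarith
    rcases mul_eq_zero.1 this with h | h
    · linarith
    · exact absurd h hpi.ne'
  have h3 : n * 2 = m * 2 - 1 := by exact_mod_cast h2
  omega

theorem continuous_equivRealProd_symm : Continuous Complex.equivRealProd.symm :=
  Complex.equivRealProdCLM.symm.continuous

/-- A closed curve in the annulus seen from the point `w`. -/
noncomputable def curveFrom (c : C(Circle, annulus)) (w : ℝ × ℝ) : C(Circle, ℂ) where
  toFun z := Complex.equivRealProd.symm ((c z : ℝ × ℝ) - w)
  continuous_toFun := continuous_equivRealProd_symm.comp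
    ((continuous_subtype_val.comp c.continuous).sub continuous_const)

theorem curveFrom_apply (c : C(Circle, annulus)) (w : ℝ × ℝ) (z : Circle) :
    curveFrom c w z = Complex.equivRealProd.symm ((c z : ℝ × ℝ) - w) := rfl

theorem curveFrom_ne_zero {c : C(Circle, annulus)} {w : ℝ × ℝ} {z : Circle}
    (h : (c z : ℝ × ℝ) ≠ w) : curveFrom c w z ≠ 0 := by
  rw [curveFrom_apply]
  intro h0
  have : (c z : ℝ × ℝ) - w = 0 := by
    have := congrArg Complex.equivRealProd h0
    rwa [Equiv.apply_symm_apply] at this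
  exact h (sub_eq_zero.1 this)

theorem ne_zero_of_mem_annulus {p : ℝ × ℝ} (hp : p ∈ annulus) : p ≠ 0 := by
  rintro rfl
  have := hp.1
  norm_num at this

/-- The homotopy stays in the annulus, hence off the origin, so the absence of a logarithm carries
over from the core circle `3z`. -/
theorem not_hasLog_curveFrom_zero {c : C(Circle, annulus)} (hc : c.Homotopic coreCircle) :
    ¬ HasLog (curveFrom c 0) := by
  obtain ⟨H⟩ := hc
  intro hlog
  have hcont : Continuous fun t : unitInterval => curveFrom (H.curry t) 0 := by
    refine ContinuousMap.continuous_of_continuous_uncurry _ ?_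
    refine continuous_equivRealProd_symm.comp (Continuous.sub ?_ continuous_const)
    exact continuous_subtype_val.comp H.continuous
  have h1 := HasLog.of_isPreconnected (isPreconnected_range hcont) ?_ ⟨0, rfl⟩ ⟨1, rfl⟩
    (by simpa using hlog)
  · refine not_hasLog_of_eq_mul (r := 3) (by norm_num) (fun z => ?_) h1
    simp only [ContinuousMap.Homotopy.curry_one, curveFrom_apply]
    apply Complex.ext <;> simp [coreCircle]
  · rintro _ ⟨t, rfl⟩ z
    exact curveFrom_ne_zero (ne_zero_of_mem_annulus (H.curry t z).2)

/-- Seen from `(6, 0)`, the curve stays at distance at most `5 < 6` from the constant `-6`. -/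
theorem hasLog_curveFrom_far (c : C(Circle, annulus)) : HasLog (curveFrom c (6, 0)) := by
  have h6 : HasLog (ContinuousMap.const Circle (-6 : ℂ)) :=
    ⟨ContinuousMap.const Circle (Complex.log (-6)), fun z => by
      simpa using Complex.exp_log (by norm_num)⟩
  refine h6.of_norm_sub_lt fun z => ?_
  obtain ⟨⟨⟨x, y⟩, hmem⟩, hxy⟩ : ∃ p : annulus, p = c z := ⟨_, rfl⟩
  have heq : curveFrom c (6, 0) z - ContinuousMap.const Circle (-6 : ℂ) z = ⟨x, y⟩ := by
    rw [curveFrom_apply, ← hxy]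
    apply Complex.ext <;> simp
  rw [heq]
  have h25 : x ^ 2 + y ^ 2 ≤ 25 := hmem.2
  have : ‖(⟨x, y⟩ : ℂ)‖ ^ 2 < 6 ^ 2 := by
    rw [Complex.sq_norm, Complex.normSq_mk]
    nlinarith
  simpa using lt_of_pow_lt_pow_left₀ 2 (by norm_num) this

/-- An essential curve separates the origin from the outside of the annulus. -/
theorem far_notMem_connectedComponentIn {c : C(Circle, annulus)}
    (hc : c.Homotopic coreCircle) :
    ((6, 0) : ℝ × ℝ) ∉
      connectedComponentIn ((Subtype.val '' Set.range c)ᶜ : Set (ℝ × ℝ)) 0 := by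
  intro hmem
  set F : Set (ℝ × ℝ) := (Subtype.val '' Set.range c)ᶜ with hF
  have h0 : (0 : ℝ × ℝ) ∈ F := connectedComponentIn_nonempty_iff.1 ⟨_, hmem⟩
  have hcont : Continuous fun w : ℝ × ℝ => curveFrom c w := by
    refine ContinuousMap.continuous_of_continuous_uncurry _ ?_
    refine continuous_equivRealProd_symm.comp (Continuous.sub ?_ continuous_fst)
    exact continuous_subtype_val.comp (c.continuous.comp continuous_snd)
  -- Moving the viewpoint through one component of the complement keeps the curve nonvanishing, so a
  -- logarithm at `(6, 0)` would yield one at `0`.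
  refine not_hasLog_curveFrom_zero hc (HasLog.of_isPreconnected
    (isPreconnected_connectedComponentIn.image (curveFrom c) hcont.continuousOn) ?_
    ⟨_, hmem, rfl⟩ ⟨_, mem_connectedComponentIn h0, rfl⟩ (hasLog_curveFrom_far c))
  rintro _ ⟨w, hw, rfl⟩ z
  refine curveFrom_ne_zero fun h => ?_
  exact connectedComponentIn_subset _ _ hw ⟨c z, ⟨z, rfl⟩, h⟩

/-! ### The intersection property of the rotation. -/

/-- The rotation by `π / 2` of the whole plane. -/
def planeRotation : (ℝ × ℝ) ≃ₜ (ℝ × ℝ) where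
  toFun p := (-p.2, p.1)
  invFun p := (p.2, -p.1)
  left_inv p := by simp
  right_inv p := by simp
  continuous_toFun := by fun_prop
  continuous_invFun := by fun_prop

theorem planeRotation_four (p : ℝ × ℝ) :
    planeRotation (planeRotation (planeRotation (planeRotation p))) = p := by
  simp [planeRotation]

/-- A frontier point off `K` would have an open component of its own meeting that of `a`; the two
then coincide and the point is interior. -/
theorem frontier_connectedComponentIn_subset {K : Set (ℝ × ℝ)} (hK : IsClosed K) (a : ℝ × ℝ) :
    frontier (connectedComponentIn Kᶜ a) ⊆ K := by
  intro x hx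
  by_contra hxK
  have hxx : x ∈ connectedComponentIn Kᶜ x := mem_connectedComponentIn hxK
  obtain ⟨y, hyx, hya⟩ := mem_closure_iff.1 hx.1 _ hK.isOpen_compl.connectedComponentIn hxx
  have hopen : IsOpen (connectedComponentIn Kᶜ a) := hK.isOpen_compl.connectedComponentIn
  rw [connectedComponentIn_eq hya, ← connectedComponentIn_eq hyx] at hx
  refine hx.2 ?_
  rw [hK.isOpen_compl.connectedComponentIn.interior_eq]
  exact hxx

/-- A compact connected set which is disjoint from its rotated image contains that image in any of
its complementary components whose base point is not separated from its own rotated image. -/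
theorem rotation_image_subset_component {K : Set (ℝ × ℝ)} (hK : IsClosed K)
    (hKc : IsConnected K) (hdisj : Disjoint (planeRotation '' K) K) {a : ℝ × ℝ} (ha : a ∉ K)
    (hrot : a ∈ connectedComponentIn (planeRotation '' K)ᶜ (planeRotation a)) :
    planeRotation '' K ⊆ connectedComponentIn Kᶜ a := by
  set W := connectedComponentIn Kᶜ a with hW
  have hsub : planeRotation '' K ⊆ Kᶜ := hdisj.subset_compl_right
  by_cases hne : ((planeRotation '' K) ∩ W).Nonempty
  · obtain ⟨y, hy, hyW⟩ := hne
    rw [hW, connectedComponentIn_eq hyW]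
    exact (hKc.image _ planeRotation.continuous.continuousOn).isPreconnected
      |>.subset_connectedComponentIn hy hsub
  exfalso
  have haW : a ∈ W := mem_connectedComponentIn ha
  have hRW : planeRotation '' W = connectedComponentIn (planeRotation '' K)ᶜ a := by
    rw [hW, planeRotation.image_connectedComponentIn ha,
      Set.image_compl_eq planeRotation.bijective, connectedComponentIn_eq hrot]
  -- If the rotated set misses `W`, then `W` is a connected subset of its complement containing `a`,
  -- hence lies in the component there, which is the rotated `W`.
  have hWR : W ⊆ planeRotation '' W := by
    rw [hRW]
    refine isPreconnected_connectedComponentIn.subset_connectedComponentIn haW ?_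
    intro x hx hxK
    exact hne ⟨x, hxK, hx⟩
  have hEq : planeRotation '' W = W := by
    refine Set.Subset.antisymm ?_ hWR
    -- Three applications of the inclusion write `x` as the third rotate of some `v ∈ W`; one more
    -- rotation returns to `v`, since the order is four.
    have h4 : ∀ x ∈ W, planeRotation x ∈ W := by
      have hstep : ∀ V : Set (ℝ × ℝ), W ⊆ V → W ⊆ planeRotation '' V := fun V hV =>
        hWR.trans (Set.image_mono hV)
      intro x hx
      obtain ⟨y, ⟨z, ⟨v, hv, rfl⟩, rfl⟩, rfl⟩ := hstep _ (hstep _ hWR) hx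
      rwa [planeRotation_four]
    rintro _ ⟨x, hx, rfl⟩
    exact h4 x hx
  have hWne : W ≠ Set.univ := by
    intro h
    obtain ⟨x, hx⟩ := hKc.nonempty
    exact connectedComponentIn_subset _ _ (h ▸ Set.mem_univ x : x ∈ W) hx
  -- The frontier of the invariant set `W` lies both in `K` and in its rotated image, which are
  -- disjoint.
  obtain ⟨x, hx⟩ := nonempty_frontier_iff.2 ⟨⟨a, haW⟩, hWne⟩
  have hfr := frontier_connectedComponentIn_subset hK a
  refine Set.disjoint_left.1 hdisj ?_ (hfr hx)
  rw [← hEq, ← planeRotation.image_frontier] at hx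
  exact Set.image_mono hfr hx

/-- The sphere of radius `6` is a square here, the norm being the sup norm. It is connected, avoids
the annulus, and contains both points. -/
theorem far_mem_rotated_component {L : Set (ℝ × ℝ)} (hL : L ⊆ annulus) :
    ((6, 0) : ℝ × ℝ) ∈ connectedComponentIn Lᶜ (planeRotation (6, 0)) := by
  have hrank : 1 < Module.rank ℝ (ℝ × ℝ) := by simp [one_add_one_eq_two]
  have hs := (isConnected_sphere hrank (0 : ℝ × ℝ) (r := 6) (by norm_num)).isPreconnected
  refine hs.subset_connectedComponentIn ?_ ?_ ?_
  · simp [planeRotation, Prod.norm_def]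
  · intro p hp hpL
    have h1 := (hL hpL).2
    have h2 : max |p.1| |p.2| = 6 := by simpa [Prod.norm_def] using hp
    rcases max_choice |p.1| |p.2| with h | h
    · have : |p.1| ^ 2 = 36 := by rw [← h, h2]; norm_num
      rw [sq_abs] at this
      nlinarith [sq_nonneg p.2]
    · have : |p.2| ^ 2 = 36 := by rw [← h, h2]; norm_num
      rw [sq_abs] at this
      nlinarith [sq_nonneg p.1]
  · simp [Prod.norm_def]

theorem planeRotation_coe (p : annulus) : planeRotation p = rotation p := rfl

/-- Were the rotated curve disjoint from the curve, it would lie in the component of `0`, a fixed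
point, and in that of `(6, 0)`; the two would coincide, although the curve separates them. -/
theorem rotation_hasIntersectionProperty : HasIntersectionProperty rotation := by
  rintro K ⟨c, -, hc, rfl⟩
  by_contra hne
  set L : Set (ℝ × ℝ) := Subtype.val '' Set.range c with hLdef
  have hLann : L ⊆ annulus := by
    rintro _ ⟨p, -, rfl⟩
    exact p.2
  have hRL : planeRotation '' L ⊆ annulus := by
    rintro _ ⟨_, ⟨p, -, rfl⟩, rfl⟩
    exact (rotation p).2
  have hcomp : IsCompact L :=
    (isCompact_range c.continuous).image continuous_subtype_val
  have hconn : IsConnected L :=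
    (isConnected_range c.continuous).image _ continuous_subtype_val.continuousOn
  have hdisj : Disjoint (planeRotation '' L) L := by
    rw [Set.disjoint_left]
    rintro _ ⟨_, ⟨p, hp, rfl⟩, rfl⟩ ⟨q, hq, hqp⟩
    refine hne ⟨q, ⟨p, hp, ?_⟩, hq⟩
    exact Subtype.ext hqp.symm
  have h0L : (0 : ℝ × ℝ) ∉ L := fun h => ne_zero_of_mem_annulus (hLann h) rfl
  have h0RL : (0 : ℝ × ℝ) ∉ planeRotation '' L := fun h => ne_zero_of_mem_annulus (hRL h) rfl
  have h6L : ((6, 0) : ℝ × ℝ) ∉ L := fun h => by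
    have := (hLann h).2
    norm_num at this
  have hrot0 : planeRotation 0 = 0 := by simp [planeRotation]
  have hA := rotation_image_subset_component hcomp.isClosed hconn hdisj h0L
    (by rw [hrot0]; exact mem_connectedComponentIn h0RL)
  have hB := rotation_image_subset_component hcomp.isClosed hconn hdisj h6L
    (far_mem_rotated_component hRL)
  obtain ⟨x, hx⟩ := hconn.nonempty.image planeRotation
  have h1 := connectedComponentIn_eq (hA hx)
  rw [← connectedComponentIn_eq (hB hx)] at h1
  have h2 : ((6, 0) : ℝ × ℝ) ∈ connectedComponentIn Lᶜ 0 := by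
    rw [h1]
    exact mem_connectedComponentIn h6L
  exact far_notMem_connectedComponentIn hc h2

/-! ### The radial elliptic coordinate -/

noncomputable def invChi (ρ : ℝ) : ℝ := (ρ + 1) / (7 * ρ - 5)

noncomputable def invEta (ρ : ℝ) : ℝ := (7 - ρ) / (ρ + 5)

theorem chi_mul_invChi {ρ : ℝ} (hρ : ρ ∈ Set.Ioo (5 / 7 : ℝ) 7) : chi ρ * invChi ρ = 1 := by
  have h1 : ρ + 1 ≠ 0 := by linarith [hρ.1]
  have h2 : 7 * ρ - 5 ≠ 0 := by linarith [hρ.1]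
  rw [chi, invChi]
  field_simp

theorem eta_mul_invEta {ρ : ℝ} (hρ : ρ ∈ Set.Ioo (5 / 7 : ℝ) 7) : eta ρ * invEta ρ = 1 := by
  have h1 : ρ + 5 ≠ 0 := by linarith [hρ.1]
  have h2 : 7 - ρ ≠ 0 := by linarith [hρ.2]
  rw [eta, invEta]
  field_simp

/-- On `(5/7, 7)`, from the zero of `chi` to the pole of `eta`, both semiaxes are positive and
increasing. The margin around `[1, 5]` gives analyticity up to the boundary circles. -/
theorem Icc_subset_Ioo_domain : Set.Icc (1 : ℝ) 5 ⊆ Set.Ioo (5 / 7) 7 := fun _ h =>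
  ⟨by linarith [h.1], by linarith [h.2]⟩

theorem invChi_pos {ρ : ℝ} (hρ : ρ ∈ Set.Ioo (5 / 7 : ℝ) 7) : 0 < invChi ρ :=
  div_pos (by linarith [hρ.1]) (by linarith [hρ.1])

theorem invEta_pos {ρ : ℝ} (hρ : ρ ∈ Set.Ioo (5 / 7 : ℝ) 7) : 0 < invEta ρ :=
  div_pos (by linarith [hρ.2]) (by linarith [hρ.1])

theorem invChi_strictAnti : StrictAntiOn invChi (Set.Ioo (5 / 7) 7) := by
  intro a ha b hb hab
  rw [invChi, invChi, div_lt_div_iff₀ (by linarith [hb.1]) (by linarith [ha.1])]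
  nlinarith

theorem invEta_strictAnti : StrictAntiOn invEta (Set.Ioo (5 / 7) 7) := by
  intro a ha b hb hab
  rw [invEta, invEta, div_lt_div_iff₀ (by linarith [hb.1]) (by linarith [ha.1])]
  nlinarith

theorem chi_strictMono : StrictMonoOn chi (Set.Ioo (5 / 7) 7) := by
  intro a ha b hb hab
  rw [chi, chi, div_lt_div_iff₀ (by linarith [ha.1]) (by linarith [hb.1])]
  nlinarith

theorem eta_strictMono : StrictMonoOn eta (Set.Ioo (5 / 7) 7) := by
  intro a ha b hb hab
  rw [eta, eta, div_lt_div_iff₀ (by linarith [ha.2]) (by linarith [hb.2])]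
  nlinarith

theorem chi_mem_Icc {ρ : ℝ} (hρ : ρ ∈ Set.Icc (1 : ℝ) 5) : chi ρ ∈ Set.Icc (1 : ℝ) 5 := by
  have h : 0 < ρ + 1 := by linarith [hρ.1]
  constructor
  · rw [chi, le_div_iff₀ h]; linarith [hρ.1]
  · rw [chi, div_le_iff₀ h]; linarith [hρ.2]

theorem eta_mem_Icc {ρ : ℝ} (hρ : ρ ∈ Set.Icc (1 : ℝ) 5) : eta ρ ∈ Set.Icc (1 : ℝ) 5 := by
  have h : 0 < 7 - ρ := by linarith [hρ.2]
  constructor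
  · rw [eta, le_div_iff₀ h]; linarith [hρ.1]
  · rw [eta, div_le_iff₀ h]; linarith [hρ.2]

theorem mem_annulus_of_semiaxes {a b c s : ℝ} (ha : a ∈ Set.Icc (1 : ℝ) 5)
    (hb : b ∈ Set.Icc (1 : ℝ) 5) (h : c ^ 2 + s ^ 2 = 1) : (a * c, b * s) ∈ annulus := by
  have ha1 : 1 ≤ a ^ 2 := by nlinarith [ha.1]
  have ha2 : a ^ 2 ≤ 25 := by nlinarith [ha.1, ha.2]
  have hb1 : 1 ≤ b ^ 2 := by nlinarith [hb.1]
  have hb2 : b ^ 2 ≤ 25 := by nlinarith [hb.1, hb.2]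
  constructor <;> simp only [mul_pow] <;> nlinarith [sq_nonneg c, sq_nonneg s]

theorem ellipticPoint_mem {ρ : ℝ} (hρ : ρ ∈ Set.Icc (1 : ℝ) 5) (ϑ : ℝ) :
    ellipticPoint (ρ, ϑ) ∈ annulus :=
  mem_annulus_of_semiaxes (chi_mem_Icc hρ) (eta_mem_Icc hρ) (Real.cos_sq_add_sin_sq ϑ)

/-- The point `p` lies on the ellipse with elliptic coordinate `ρ` iff `levelEq (p, ρ) = 0`. -/
noncomputable def levelEq (z : (ℝ × ℝ) × ℝ) : ℝ :=
  (z.1.1 * invChi z.2) ^ 2 + (z.1.2 * invEta z.2) ^ 2 - 1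

/-- Both reciprocal semiaxes strictly decrease in `ρ`, so two ellipses of the family could share
only the origin, which lies on none of them. -/
theorem levelEq_inj {p : ℝ × ℝ} {a b : ℝ} (ha : a ∈ Set.Ioo (5 / 7 : ℝ) 7)
    (hb : b ∈ Set.Ioo (5 / 7 : ℝ) 7) (h1 : levelEq (p, a) = 0) (h2 : levelEq (p, b) = 0) :
    a = b := by
  have key : ∀ a ∈ Set.Ioo (5 / 7 : ℝ) 7, ∀ b ∈ Set.Ioo (5 / 7 : ℝ) 7, a < b →
      levelEq (p, a) = 0 → levelEq (p, b) = 0 → False := by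
    intro a ha b hb hab h1 h2
    have hA : invChi b ^ 2 < invChi a ^ 2 :=
      pow_lt_pow_left₀ (invChi_strictAnti ha hb hab) (invChi_pos hb).le (by norm_num)
    have hB : invEta b ^ 2 < invEta a ^ 2 :=
      pow_lt_pow_left₀ (invEta_strictAnti ha hb hab) (invEta_pos hb).le (by norm_num)
    simp only [levelEq, mul_pow] at h1 h2
    have hx : p.1 ^ 2 * invChi b ^ 2 ≤ p.1 ^ 2 * invChi a ^ 2 := by gcongr
    have hy : p.2 ^ 2 * invEta b ^ 2 ≤ p.2 ^ 2 * invEta a ^ 2 := by gcongr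
    have hx0 : p.1 ^ 2 = 0 := by
      have : p.1 ^ 2 * (invChi a ^ 2 - invChi b ^ 2) = 0 := by linarith
      exact (mul_eq_zero.1 this).resolve_right (by linarith)
    have hy0 : p.2 ^ 2 = 0 := by
      have : p.2 ^ 2 * (invEta a ^ 2 - invEta b ^ 2) = 0 := by linarith
      exact (mul_eq_zero.1 this).resolve_right (by linarith)
    rw [hx0, hy0] at h1
    linarith
  rcases lt_trichotomy a b with h | h | h
  · exact (key a ha b hb h h1 h2).elim
  · exact h
  · exact (key b hb a ha h h2 h1).elim

theorem levelEq_ellipticPoint {ρ : ℝ} (hρ : ρ ∈ Set.Ioo (5 / 7 : ℝ) 7) (ϑ : ℝ) :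
    levelEq (ellipticPoint (ρ, ϑ), ρ) = 0 := by
  have h1 := chi_mul_invChi hρ
  have h2 := eta_mul_invEta hρ
  have h3 := Real.cos_sq_add_sin_sq ϑ
  simp only [levelEq, ellipticPoint]
  rw [mul_right_comm, h1, mul_right_comm, h2]
  linarith

/-- The radial elliptic coordinate of a point of the plane. -/
noncomputable def radial (p : ℝ × ℝ) : ℝ :=
  Classical.epsilon fun ρ => ρ ∈ Set.Ioo (5 / 7 : ℝ) 7 ∧ levelEq (p, ρ) = 0

theorem radial_eq {p : ℝ × ℝ} {ρ : ℝ} (hρ : ρ ∈ Set.Ioo (5 / 7 : ℝ) 7)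
    (h : levelEq (p, ρ) = 0) : radial p = ρ := by
  have := Classical.epsilon_spec
    (p := fun ρ => ρ ∈ Set.Ioo (5 / 7 : ℝ) 7 ∧ levelEq (p, ρ) = 0) ⟨ρ, hρ, h⟩
  exact levelEq_inj this.1 hρ this.2 h

theorem radial_ellipticPoint {ρ : ℝ} (hρ : ρ ∈ Set.Icc (1 : ℝ) 5) (ϑ : ℝ) :
    radial (ellipticPoint (ρ, ϑ)) = ρ :=
  radial_eq (Icc_subset_Ioo_domain hρ) (levelEq_ellipticPoint (Icc_subset_Ioo_domain hρ) ϑ)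

theorem exists_cos_sin {c s : ℝ} (h : c ^ 2 + s ^ 2 = 1) :
    ∃ ϑ ∈ Set.Ico 0 (2 * Real.pi), c = Real.cos ϑ ∧ s = Real.sin ϑ := by
  have hn : ‖(⟨c, s⟩ : ℂ)‖ = 1 := by
    rw [← sq_eq_sq₀ (norm_nonneg _) zero_le_one, Complex.sq_norm, Complex.normSq_mk]
    linarith
  have h1 := Complex.norm_mul_cos_arg ⟨c, s⟩
  have h2 := Complex.norm_mul_sin_arg ⟨c, s⟩
  rw [hn, one_mul] at h1 h2
  refine ⟨toIcoMod Real.two_pi_pos 0 (Complex.arg ⟨c, s⟩), ?_, ?_, ?_⟩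
  · simpa using toIcoMod_mem_Ico Real.two_pi_pos 0 (Complex.arg ⟨c, s⟩)
  · rw [toIcoMod, zsmul_eq_mul, Real.cos_sub_int_mul_two_pi, h1]
  · rw [toIcoMod, zsmul_eq_mul, Real.sin_sub_int_mul_two_pi, h2]

theorem exists_levelEq {p : ℝ × ℝ} (hp : p ∈ annulus) :
    ∃ ρ ∈ Set.Icc (1 : ℝ) 5, levelEq (p, ρ) = 0 := by
  have hcont : ContinuousOn (fun ρ => levelEq (p, ρ)) (Set.Icc 1 5) := by
    intro ρ hρ
    have h1 : 7 * ρ - 5 ≠ 0 := by linarith [hρ.1]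
    have h2 : ρ + 5 ≠ 0 := by linarith [hρ.1]
    refine ContinuousAt.continuousWithinAt ?_
    simp only [levelEq, invChi, invEta]
    fun_prop (disch := assumption)
  -- For `ρ = 1` and `ρ = 5` the ellipses are the boundary circles of radii `1` and `5`.
  have h0 : (0 : ℝ) ∈ Set.Icc (levelEq (p, 5)) (levelEq (p, 1)) := by
    have h1 := hp.1
    have h2 := hp.2
    constructor <;> norm_num [levelEq, invChi, invEta, mul_pow] <;> linarith
  exact intermediate_value_Icc' (by norm_num) hcont h0

theorem exists_ellipticPoint {p : ℝ × ℝ} (hp : p ∈ annulus) :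
    ∃ ρ ∈ Set.Icc (1 : ℝ) 5, ∃ ϑ ∈ Set.Ico 0 (2 * Real.pi), ellipticPoint (ρ, ϑ) = p := by
  obtain ⟨ρ, hρ, h⟩ := exists_levelEq hp
  obtain ⟨ϑ, hϑ, hc, hs⟩ := exists_cos_sin (c := p.1 * invChi ρ) (s := p.2 * invEta ρ)
    (by rw [levelEq] at h; linarith)
  refine ⟨ρ, hρ, ϑ, hϑ, ?_⟩
  have h1 := chi_mul_invChi (Icc_subset_Ioo_domain hρ)
  have h2 := eta_mul_invEta (Icc_subset_Ioo_domain hρ)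
  rw [ellipticPoint]
  ext
  · simp only [← hc]
    linear_combination p.1 * h1
  · simp only [← hs]
    linear_combination p.2 * h2

theorem radial_mem {p : ℝ × ℝ} (hp : p ∈ annulus) : radial p ∈ Set.Icc (1 : ℝ) 5 := by
  obtain ⟨ρ, hρ, ϑ, -, rfl⟩ := exists_ellipticPoint hp
  rwa [radial_ellipticPoint hρ]

theorem bijOn_ellipticPoint :
    Set.BijOn ellipticPoint (Set.Icc 1 5 ×ˢ Set.Ico 0 (2 * Real.pi)) annulus := by
  refine ⟨fun q hq => ellipticPoint_mem hq.1 q.2, ?_, ?_⟩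
  · rintro ⟨ρ, ϑ⟩ ⟨hρ, hϑ⟩ ⟨ρ', ϑ'⟩ ⟨hρ', hϑ'⟩ h
    simp only at hρ hϑ hρ' hϑ'
    have h1 : ρ = ρ' := by
      rw [← radial_ellipticPoint hρ ϑ, h, radial_ellipticPoint hρ' ϑ']
    subst h1
    simp only [ellipticPoint, Prod.mk.injEq] at h
    have hc := mul_left_cancel₀ (by linarith [(chi_mem_Icc hρ).1]) h.1
    have hs := mul_left_cancel₀ (by linarith [(eta_mem_Icc hρ).1]) h.2
    obtain ⟨k, hk⟩ := Real.Angle.angle_eq_iff_two_pi_dvd_sub.1 (Real.Angle.cos_sin_inj hc hs)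
    have hpi := Real.pi_pos
    have hk1 : (-1 : ℝ) < k := by
      by_contra hcon
      nlinarith [hϑ.1, hϑ'.2]
    have hk2 : (k : ℝ) < 1 := by
      by_contra hcon
      nlinarith [hϑ.2, hϑ'.1]
    have hk0 : k = 0 := by
      have h3 : -1 < k := by exact_mod_cast hk1
      have h4 : k < 1 := by exact_mod_cast hk2
      omega
    rw [hk0] at hk
    simp only [Int.cast_zero, mul_zero] at hk
    rw [sub_eq_zero.1 hk]
  · intro p hp
    obtain ⟨ρ, hρ, ϑ, hϑ, h⟩ := exists_ellipticPoint hp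
    exact ⟨(ρ, ϑ), ⟨hρ, hϑ⟩, h⟩

theorem hasDerivAt_chi {ρ : ℝ} (hρ : ρ + 1 ≠ 0) :
    HasDerivAt chi (12 / (ρ + 1) ^ 2) ρ := by
  have h1 : HasDerivAt (fun ρ : ℝ => 7 * ρ - 5) 7 ρ := by
    simpa using ((hasDerivAt_id ρ).const_mul 7).sub_const 5
  have h2 : HasDerivAt (fun ρ : ℝ => ρ + 1) 1 ρ := (hasDerivAt_id ρ).add_const 1
  refine HasDerivAt.congr_deriv (h1.div h2 hρ) ?_
  ring

theorem hasDerivAt_eta {ρ : ℝ} (hρ : 7 - ρ ≠ 0) :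
    HasDerivAt eta (12 / (7 - ρ) ^ 2) ρ := by
  have h1 : HasDerivAt (fun ρ : ℝ => ρ + 5) 1 ρ := (hasDerivAt_id ρ).add_const 5
  have h2 : HasDerivAt (fun ρ : ℝ => 7 - ρ) (-1) ρ := by
    simpa using (hasDerivAt_id ρ).const_sub 7
  refine HasDerivAt.congr_deriv (h1.div h2 hρ) ?_
  ring

theorem hasDerivAt_invChi {ρ : ℝ} (hρ : 7 * ρ - 5 ≠ 0) :
    HasDerivAt invChi (-12 / (7 * ρ - 5) ^ 2) ρ := by
  have h1 : HasDerivAt (fun ρ : ℝ => 7 * ρ - 5) 7 ρ := by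
    simpa using ((hasDerivAt_id ρ).const_mul 7).sub_const 5
  have h2 : HasDerivAt (fun ρ : ℝ => ρ + 1) 1 ρ := (hasDerivAt_id ρ).add_const 1
  refine HasDerivAt.congr_deriv (h2.div h1 hρ) ?_
  ring

theorem hasDerivAt_invEta {ρ : ℝ} (hρ : ρ + 5 ≠ 0) :
    HasDerivAt invEta (-12 / (ρ + 5) ^ 2) ρ := by
  have h1 : HasDerivAt (fun ρ : ℝ => ρ + 5) 1 ρ := (hasDerivAt_id ρ).add_const 5
  have h2 : HasDerivAt (fun ρ : ℝ => 7 - ρ) (-1) ρ := by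
    simpa using (hasDerivAt_id ρ).const_sub 7
  refine HasDerivAt.congr_deriv (h2.div h1 hρ) ?_
  ring

theorem analyticAt_ellipticPoint {ρ : ℝ} (hρ : ρ ∈ Set.Icc (1 : ℝ) 5) (ϑ : ℝ) :
    AnalyticAt ℝ ellipticPoint (ρ, ϑ) := by
  have h1 : (ρ, ϑ).1 + 1 ≠ 0 := by simp only; linarith [hρ.1]
  have h2 : 7 - (ρ, ϑ).1 ≠ 0 := by simp only; linarith [hρ.2]
  have : ContDiffAt ℝ ω ellipticPoint (ρ, ϑ) := by
    unfold ellipticPoint chi eta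
    fun_prop (disch := assumption)
  exact this.analyticAt

theorem bijective_fderiv_ellipticPoint {ρ : ℝ} (hρ : ρ ∈ Set.Icc (1 : ℝ) 5) (ϑ : ℝ) :
    Function.Bijective (fderiv ℝ ellipticPoint (ρ, ϑ)) := by
  have h1 : ρ + 1 ≠ 0 := by linarith [hρ.1]
  have h2 : 7 - ρ ≠ 0 := by linarith [hρ.2]
  have hχ := (hasDerivAt_chi h1).hasFDerivAt.comp (ρ, ϑ)
    (hasFDerivAt_fst (𝕜 := ℝ) (p := (ρ, ϑ)))
  have hη := (hasDerivAt_eta h2).hasFDerivAt.comp (ρ, ϑ)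
    (hasFDerivAt_fst (𝕜 := ℝ) (p := (ρ, ϑ)))
  have hc := (Real.hasDerivAt_cos ϑ).hasFDerivAt.comp (ρ, ϑ)
    (hasFDerivAt_snd (𝕜 := ℝ) (p := (ρ, ϑ)))
  have hs := (Real.hasDerivAt_sin ϑ).hasFDerivAt.comp (ρ, ϑ)
    (hasFDerivAt_snd (𝕜 := ℝ) (p := (ρ, ϑ)))
  have hD := (hχ.mul hc).prodMk (hη.mul hs)
  have hfd : fderiv ℝ ellipticPoint (ρ, ϑ) = _ := hD.fderiv
  have hinj : Function.Injective (fderiv ℝ ellipticPoint (ρ, ϑ)) := by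
    rw [hfd, injective_iff_map_eq_zero]
    rintro ⟨u, v⟩ huv
    simp only [Function.comp_apply] at huv
    have hχ1 := (chi_mem_Icc hρ).1
    have hη1 := (eta_mem_Icc hρ).1
    have hcs := Real.cos_sq_add_sin_sq ϑ
    have ha : 0 < 12 / (ρ + 1) ^ 2 := by positivity
    have hb : 0 < 12 / (7 - ρ) ^ 2 := by positivity
    set A := 12 / (ρ + 1) ^ 2
    set B := 12 / (7 - ρ) ^ 2
    have e1 : -(chi ρ * (v * Real.sin ϑ)) + Real.cos ϑ * (u * A) = 0 := by
      simpa using congrArg Prod.fst huv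
    have e2 : eta ρ * (v * Real.cos ϑ) + Real.sin ϑ * (u * B) = 0 := by
      simpa using congrArg Prod.snd huv
    -- This is the Jacobian determinant; the two combinations below are Cramer's rule.
    have hdet : 0 < A * eta ρ * Real.cos ϑ ^ 2 + B * chi ρ * Real.sin ϑ ^ 2 := by
      have hA : 0 < A * eta ρ := by positivity
      have hB : 0 < B * chi ρ := by positivity
      rcases eq_or_ne (Real.cos ϑ) 0 with h | h
      · have : Real.sin ϑ ^ 2 = 1 := by rw [← hcs, h]; ring
        rw [this, h]
        linarith
      · have : 0 < Real.cos ϑ ^ 2 := by positivity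
        have := mul_pos hA this
        have := mul_nonneg hB.le (sq_nonneg (Real.sin ϑ))
        linarith
    have hu : u * (A * eta ρ * Real.cos ϑ ^ 2 + B * chi ρ * Real.sin ϑ ^ 2) = 0 := by
      linear_combination eta ρ * Real.cos ϑ * e1 + chi ρ * Real.sin ϑ * e2
    have hv : v * (A * eta ρ * Real.cos ϑ ^ 2 + B * chi ρ * Real.sin ϑ ^ 2) = 0 := by
      linear_combination A * Real.cos ϑ * e2 - B * Real.sin ϑ * e1
    rw [(mul_eq_zero.1 hu).resolve_right hdet.ne', (mul_eq_zero.1 hv).resolve_right hdet.ne']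
    rfl
  exact ⟨hinj, LinearMap.surjective_of_injective
    (f := (fderiv ℝ ellipticPoint (ρ, ϑ) : ℝ × ℝ →ₗ[ℝ] ℝ × ℝ)) hinj⟩

/-- The implicit function theorem applies to `levelEq`: its derivative in `ρ` is negative because `p
≠ 0`. -/
theorem analyticAt_radial {p : ℝ × ℝ} (hp : p ∈ annulus) : AnalyticAt ℝ radial p := by
  obtain ⟨ρ, hρ, h0⟩ := exists_levelEq hp
  have hρ' := Icc_subset_Ioo_domain hρ
  have h1 : 7 * ρ - 5 ≠ 0 := by linarith [hρ.1]
  have h2 : ρ + 5 ≠ 0 := by linarith [hρ.1]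
  have hg : AnalyticAt ℝ levelEq (p, ρ) := by
    have h1' : 7 * (p, ρ).2 - 5 ≠ 0 := h1
    have h2' : (p, ρ).2 + 5 ≠ 0 := h2
    have : ContDiffAt ℝ ω levelEq (p, ρ) := by
      unfold levelEq invChi invEta
      fun_prop (disch := assumption)
    exact this.analyticAt
  have hd : HasDerivAt (fun s => levelEq (p, s))
      (2 * (p.1 * invChi ρ) * (p.1 * (-12 / (7 * ρ - 5) ^ 2)) +
        2 * (p.2 * invEta ρ) * (p.2 * (-12 / (ρ + 5) ^ 2))) ρ := by
    have := ((((hasDerivAt_invChi h1).const_mul p.1).pow 2).add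
      (((hasDerivAt_invEta h2).const_mul p.2).pow 2)).sub_const 1
    simpa [levelEq] using this
  refine analyticAt_of_implicit hg hd ?_ h0 ?_
  · have hA := invChi_pos hρ'
    have hB := invEta_pos hρ'
    have ha : 0 < 12 / (7 * ρ - 5) ^ 2 := by positivity
    have hb : 0 < 12 / (ρ + 5) ^ 2 := by positivity
    have hp0 : 0 < p.1 ^ 2 + p.2 ^ 2 := by linarith [hp.1]
    have hm : 0 < invChi ρ * (12 / (7 * ρ - 5) ^ 2) := by positivity
    have hn : 0 < invEta ρ * (12 / (ρ + 5) ^ 2) := by positivity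
    have hneg : 0 < p.1 ^ 2 * (invChi ρ * (12 / (7 * ρ - 5) ^ 2)) +
        p.2 ^ 2 * (invEta ρ * (12 / (ρ + 5) ^ 2)) := by
      rcases eq_or_ne p.1 0 with h | h
      · have : 0 < p.2 ^ 2 := by rw [h] at hp0; linarith
        rw [h]
        have := mul_pos this hn
        linarith
      · have h3 : 0 < p.1 ^ 2 := by positivity
        have := mul_pos h3 hm
        have := mul_nonneg (sq_nonneg p.2) hn.le
        linarith
    have heq : (2 * (p.1 * invChi ρ) * (p.1 * (-12 / (7 * ρ - 5) ^ 2)) +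
        2 * (p.2 * invEta ρ) * (p.2 * (-12 / (ρ + 5) ^ 2))) =
        -2 * (p.1 ^ 2 * (invChi ρ * (12 / (7 * ρ - 5) ^ 2)) +
        p.2 ^ 2 * (invEta ρ * (12 / (ρ + 5) ^ 2))) := by ring
    rw [heq]
    linarith
  · have : ∀ᶠ z : (ℝ × ℝ) × ℝ in 𝓝 (p, ρ), z.2 ∈ Set.Ioo (5 / 7 : ℝ) 7 :=
      continuousAt_snd.eventually_mem (isOpen_Ioo.mem_nhds hρ')
    filter_upwards [this] with z hz hz0
    exact radial_eq hz hz0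

/-! ### The radial and the angular part of the elliptic shift -/

/-- The radial part of the elliptic shift. -/
def shiftRadial (e ρ : ℝ) : ℝ := ρ + e * P ρ

/-- The distances to the ends `1` and `5` are multiplied by factors `1 ∓ e·q` with `0 ≤ q ≤ 4·4 =
16`. -/
theorem shiftRadial_mem {e ρ : ℝ} (he : |e| < 1 / 16) (hρ : ρ ∈ Set.Icc (1 : ℝ) 5) :
    shiftRadial e ρ ∈ Set.Icc (1 : ℝ) 5 := by
  obtain ⟨he1, he2⟩ := abs_lt.1 he
  obtain ⟨h1, h5⟩ := hρ
  have hsq : (ρ - 3) ^ 2 ≤ 4 := by nlinarith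
  have h0 := sq_nonneg (ρ - 3)
  constructor
  · have h2 : (ρ - 3) ^ 2 * (5 - ρ) ≤ 16 := by nlinarith
    have h3 : 0 ≤ (ρ - 3) ^ 2 * (5 - ρ) := mul_nonneg h0 (by linarith)
    have h4 : 0 ≤ 1 - e * ((ρ - 3) ^ 2 * (5 - ρ)) := by nlinarith
    have h6 := mul_nonneg (sub_nonneg.2 h1) h4
    have h7 : shiftRadial e ρ - 1 = (ρ - 1) * (1 - e * ((ρ - 3) ^ 2 * (5 - ρ))) := by
      rw [shiftRadial, P]; ring
    linarith
  · have h2 : (ρ - 3) ^ 2 * (ρ - 1) ≤ 16 := by nlinarith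
    have h3 : 0 ≤ (ρ - 3) ^ 2 * (ρ - 1) := mul_nonneg h0 (by linarith)
    have h4 : 0 ≤ 1 + e * ((ρ - 3) ^ 2 * (ρ - 1)) := by nlinarith
    have h6 := mul_nonneg (sub_nonneg.2 h5) h4
    have h7 : 5 - shiftRadial e ρ = (5 - ρ) * (1 + e * ((ρ - 3) ^ 2 * (ρ - 1))) := by
      rw [shiftRadial, P]; ring
    linarith

theorem exists_shiftRadial_eq (e : ℝ) {ρ : ℝ} (hρ : ρ ∈ Set.Icc (1 : ℝ) 5) :
    ∃ t ∈ Set.Icc (1 : ℝ) 5, shiftRadial e t = ρ := by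
  have hc : Continuous (shiftRadial e) := by
    unfold shiftRadial P
    fun_prop
  refine intermediate_value_Icc (by norm_num) hc.continuousOn ?_
  simpa [shiftRadial, P] using hρ

/-- The shift with parameter `e` is injective on the set of `t` with `InjDomain e t`. -/
def InjDomain (e t : ℝ) : Prop :=
  ∃ w : ℝ, 2 ≤ w ∧ |t - 3| < w ∧ |e| * (4 * w ^ 3 - 8 * w) < 1

/-- With `u = s - 3`, `v = t - 3` the difference quotient is `1 + e(u + v)(u² + v² - 4)`. For `|u|,
|v| < w` and `w ≥ 2` the last two factors are bounded by `2w` and `2w² - 4`, whose product is `4w³ -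
8w`. -/
theorem shiftRadial_inj {e s t : ℝ} (hs : InjDomain e s) (ht : InjDomain e t)
    (h : shiftRadial e s = shiftRadial e t) : s = t := by
  obtain ⟨w, hw, hsw, htw, hew⟩ : ∃ w : ℝ, 2 ≤ w ∧ |s - 3| < w ∧ |t - 3| < w ∧
      |e| * (4 * w ^ 3 - 8 * w) < 1 := by
    obtain ⟨a, ha, hsa, hea⟩ := hs
    obtain ⟨b, hb, htb, heb⟩ := ht
    rcases le_total a b with hab | hab
    · exact ⟨b, hb, hsa.trans_le hab, htb, heb⟩
    · exact ⟨a, ha, hsa, htb.trans_le hab, hea⟩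
  set u := s - 3 with hu
  set v := t - 3 with hv
  have hfac : (s - t) * (1 + e * ((u + v) * (u ^ 2 + v ^ 2 - 4))) = 0 := by
    simp only [shiftRadial, P] at h
    rw [hu, hv]
    linear_combination h
  have h1 : |u + v| ≤ 2 * w := (abs_add_le u v).trans (by linarith)
  have hu2 : u ^ 2 ≤ w ^ 2 := sq_le_sq' (by linarith [abs_lt.1 hsw]) (by linarith [abs_lt.1 hsw])
  have hv2 : v ^ 2 ≤ w ^ 2 := sq_le_sq' (by linarith [abs_lt.1 htw]) (by linarith [abs_lt.1 htw])
  have h2 : |u ^ 2 + v ^ 2 - 4| ≤ 2 * w ^ 2 - 4 := by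
    rw [abs_le]
    constructor <;> nlinarith [sq_nonneg u, sq_nonneg v]
  have h3 : |e * ((u + v) * (u ^ 2 + v ^ 2 - 4))| < 1 := by
    rw [abs_mul, abs_mul]
    calc |e| * (|u + v| * |u ^ 2 + v ^ 2 - 4|) ≤ |e| * (2 * w * (2 * w ^ 2 - 4)) := by
          gcongr
      _ = |e| * (4 * w ^ 3 - 8 * w) := by ring
      _ < 1 := hew
  have h4 := (abs_lt.1 h3).1
  exact sub_eq_zero.1 ((mul_eq_zero.1 hfac).resolve_right (by linarith))

/-- At `w = 2` the bound is `16|e| < 1`, so some `w > 2` still works. This room makes `InjDomain`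
hold near `(e, t)`, as the implicit function argument requires. -/
theorem exists_injDomain_bound {e t : ℝ} (he : |e| < 1 / 16) (ht : t ∈ Set.Icc (1 : ℝ) 5) :
    ∃ w : ℝ, 2 ≤ w ∧ |t - 3| < w ∧ |e| * (4 * w ^ 3 - 8 * w) < 1 := by
  have hc : Continuous fun w : ℝ => |e| * (4 * w ^ 3 - 8 * w) := by fun_prop
  have h1 : ∀ᶠ w in 𝓝 (2 : ℝ), |e| * (4 * w ^ 3 - 8 * w) < 1 :=
    hc.continuousAt.eventually_lt_const (by linarith)
  obtain ⟨w, hw, hw2⟩ := ((h1.filter_mono nhdsWithin_le_nhds).and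
    (self_mem_nhdsWithin (a := (2 : ℝ)) (s := Set.Ioi 2))).exists
  have hw2' : (2 : ℝ) < w := hw2
  exact ⟨w, hw2'.le, abs_lt.2 ⟨by linarith [ht.1], by linarith [ht.2]⟩, hw⟩

theorem injDomain_of_mem {e t : ℝ} (he : |e| < 1 / 16) (ht : t ∈ Set.Icc (1 : ℝ) 5) :
    InjDomain e t :=
  exists_injDomain_bound he ht

theorem eventually_injDomain {e t : ℝ} (he : |e| < 1 / 16) (ht : t ∈ Set.Icc (1 : ℝ) 5) (y : ℝ) :
    ∀ᶠ z : (ℝ × ℝ) × ℝ in 𝓝 ((e, y), t), InjDomain z.1.1 z.2 := by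
  obtain ⟨w, hw, h1, h2⟩ := exists_injDomain_bound he ht
  have hc1 : Continuous fun z : (ℝ × ℝ) × ℝ => |z.2 - 3| := by fun_prop
  have hc2 : Continuous fun z : (ℝ × ℝ) × ℝ => |z.1.1| * (4 * w ^ 3 - 8 * w) := by fun_prop
  filter_upwards [(hc1.tendsto (((e, y), t))).eventually_lt_const h1,
    (hc2.tendsto (((e, y), t))).eventually_lt_const h2] with z h3 h4
  exact ⟨w, hw, h3, h4⟩

/-- The inverse of the radial shift, as a function of the parameter and the argument. -/
noncomputable def unshiftRadial (z : ℝ × ℝ) : ℝ :=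
  Classical.epsilon fun t => InjDomain z.1 t ∧ shiftRadial z.1 t = z.2

theorem unshiftRadial_eq {e t : ℝ} (ht : InjDomain e t) :
    unshiftRadial (e, shiftRadial e t) = t := by
  have := Classical.epsilon_spec
    (p := fun s => InjDomain e s ∧ shiftRadial e s = shiftRadial e t) ⟨t, ht, rfl⟩
  exact shiftRadial_inj this.1 ht this.2

theorem hasDerivAt_shiftRadial (e t : ℝ) :
    HasDerivAt (shiftRadial e) (1 + e * (4 * (t - 3) ^ 3 - 8 * (t - 3))) t := by
  have h1 : HasDerivAt (fun t : ℝ => t - 3) 1 t := (hasDerivAt_id t).sub_const 3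
  have heq : shiftRadial e = fun t => t + e * ((t - 3) ^ 4 - 4 * (t - 3) ^ 2) := by
    funext t
    rw [shiftRadial, P]
    ring
  rw [heq]
  refine HasDerivAt.congr_deriv ((hasDerivAt_id t).add
    (((h1.pow 4).sub ((h1.pow 2).const_mul 4)).const_mul e)) ?_
  norm_num only
  ring

theorem analyticAt_unshiftRadial {e ρ : ℝ} (he : |e| < 1 / 16) (hρ : ρ ∈ Set.Icc (1 : ℝ) 5) :
    AnalyticAt ℝ unshiftRadial (e, ρ) := by
  obtain ⟨t, ht, rfl⟩ := exists_shiftRadial_eq e hρ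
  have hg : AnalyticAt ℝ (fun z : (ℝ × ℝ) × ℝ => shiftRadial z.1.1 z.2 - z.1.2)
      ((e, shiftRadial e t), t) := by
    have : ContDiffAt ℝ ω (fun z : (ℝ × ℝ) × ℝ => shiftRadial z.1.1 z.2 - z.1.2)
        ((e, shiftRadial e t), t) := by
      unfold shiftRadial P
      fun_prop
    exact this.analyticAt
  refine analyticAt_of_implicit hg ((hasDerivAt_shiftRadial e t).sub_const _) ?_ (sub_self _) ?_
  · have h1 : |4 * (t - 3) ^ 3 - 8 * (t - 3)| ≤ 16 := by
      have h2 : -2 ≤ t - 3 := by linarith [ht.1]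
      have h3 : t - 3 ≤ 2 := by linarith [ht.2]
      set u := t - 3
      rw [abs_le]
      constructor
      · nlinarith [mul_nonneg (sq_nonneg (u - 1)) (by linarith : 0 ≤ u + 2)]
      · nlinarith [mul_nonneg (sq_nonneg (u + 1)) (by linarith : 0 ≤ 2 - u)]
    have h2 : |e * (4 * (t - 3) ^ 3 - 8 * (t - 3))| < 1 := by
      rw [abs_mul]
      nlinarith [abs_nonneg e]
    have := (abs_lt.1 h2).1
    linarith
  · filter_upwards [eventually_injDomain he ht (shiftRadial e t)] with z hz hz0
    have : z.1 = (z.1.1, shiftRadial z.1.1 z.2) := Prod.ext rfl (sub_eq_zero.1 hz0).symm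
    rw [this]
    exact unshiftRadial_eq hz

/-- The equation for the angular displacement of the inverse shift, where `z = ((e, u, v), s)`
and `u`, `v` are the sine and the cosine of the doubled angle. -/
noncomputable def angleEq (z : (ℝ × ℝ × ℝ) × ℝ) : ℝ :=
  z.2 + z.1.1 * (z.1.2.1 * Real.cos (2 * z.2) + z.1.2.2 * Real.sin (2 * z.2))

theorem hasDerivAt_angleEq (y : ℝ × ℝ × ℝ) (s : ℝ) :
    HasDerivAt (fun s => angleEq (y, s))
      (1 + y.1 * (-(2 * y.2.1 * Real.sin (2 * s)) + 2 * y.2.2 * Real.cos (2 * s))) s := by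
  have h2 : HasDerivAt (fun s : ℝ => 2 * s) 2 s := by
    simpa using (hasDerivAt_id s).const_mul 2
  refine HasDerivAt.congr_deriv ((hasDerivAt_id s).add
    (((h2.cos.const_mul y.2.1).add (h2.sin.const_mul y.2.2)).const_mul y.1)) ?_
  ring

/-- This is Cauchy–Schwarz in the form of a sum of two squares. The hypothesis is an inequality and
not `u² + v² = 1` so that it is open in the parameters. -/
theorem angleEq_deriv_pos {y : ℝ × ℝ × ℝ} (hy : 4 * y.1 ^ 2 * (y.2.1 ^ 2 + y.2.2 ^ 2) < 1)
    (s : ℝ) :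
    0 < 1 + y.1 * (-(2 * y.2.1 * Real.sin (2 * s)) + 2 * y.2.2 * Real.cos (2 * s)) := by
  obtain ⟨e, u, v⟩ := y
  simp only at hy ⊢
  have h := Real.sin_sq_add_cos_sq (2 * s)
  set S := Real.sin (2 * s)
  set C := Real.cos (2 * s)
  have h1 : (e * (-(2 * u * S) + 2 * v * C)) ^ 2 ≤ 4 * e ^ 2 * (u ^ 2 + v ^ 2) := by
    have h2 : 4 * e ^ 2 * (u ^ 2 + v ^ 2) =
        (e * (-(2 * u * S) + 2 * v * C)) ^ 2 + (2 * e * (u * C + v * S)) ^ 2 := by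
      linear_combination -4 * e ^ 2 * (u ^ 2 + v ^ 2) * h
    rw [h2]
    linarith [sq_nonneg (2 * e * (u * C + v * S))]
  have h3 := abs_lt_of_sq_lt_sq (a := e * (-(2 * u * S) + 2 * v * C)) (b := 1)
    (by linarith) zero_le_one
  linarith [(abs_lt.1 h3).1]

theorem angleEq_strictMono {y : ℝ × ℝ × ℝ}
    (hy : 4 * y.1 ^ 2 * (y.2.1 ^ 2 + y.2.2 ^ 2) < 1) : StrictMono fun s => angleEq (y, s) := by
  refine strictMono_of_deriv_pos fun s => ?_
  rw [(hasDerivAt_angleEq y s).deriv]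
  exact angleEq_deriv_pos hy s

/-- The angular displacement of the inverse shift. -/
noncomputable def unshiftAngle (y : ℝ × ℝ × ℝ) : ℝ :=
  Classical.epsilon fun s => angleEq (y, s) = 0

theorem unshiftAngle_eq_of_angleEq {y : ℝ × ℝ × ℝ}
    (hy : 4 * y.1 ^ 2 * (y.2.1 ^ 2 + y.2.2 ^ 2) < 1) {s : ℝ} (hs : angleEq (y, s) = 0) :
    unshiftAngle y = s := by
  have h := Classical.epsilon_spec (p := fun s => angleEq (y, s) = 0) ⟨s, hs⟩
  exact (angleEq_strictMono hy).injective (h.trans hs.symm)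

theorem four_sq_mul_lt_one {e u v : ℝ} (he : |e| < 1 / 2) (huv : u ^ 2 + v ^ 2 = 1) :
    4 * e ^ 2 * (u ^ 2 + v ^ 2) < 1 := by
  have := sq_lt_sq' (abs_lt.1 he).1 (abs_lt.1 he).2
  rw [huv]
  linarith

theorem exists_shiftAngle_eq {e : ℝ} (he : |e| < 1 / 2) (φ : ℝ) :
    ∃ ϑ, ϑ + e * Real.sin (2 * ϑ) = φ := by
  have hc : Continuous fun ϑ : ℝ => ϑ + e * Real.sin (2 * ϑ) := by fun_prop
  have hb : ∀ ϑ : ℝ, |e * Real.sin (2 * ϑ)| ≤ 1 := fun ϑ => by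
    rw [abs_mul]
    nlinarith [Real.abs_sin_le_one (2 * ϑ), abs_nonneg e]
  obtain ⟨ϑ, -, h⟩ := intermediate_value_Icc (by linarith : φ - 1 ≤ φ + 1) hc.continuousOn
    (show φ ∈ Set.Icc _ _ from ⟨by linarith [(abs_le.1 (hb (φ - 1))).2],
      by linarith [(abs_le.1 (hb (φ + 1))).1]⟩)
  exact ⟨ϑ, h⟩

theorem sq_two_mul_add_sq_sub {c s : ℝ} (h : c ^ 2 + s ^ 2 = 1) :
    (2 * s * c) ^ 2 + (c ^ 2 - s ^ 2) ^ 2 = 1 := by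
  have : (2 * s * c) ^ 2 + (c ^ 2 - s ^ 2) ^ 2 = (c ^ 2 + s ^ 2) ^ 2 := by ring
  rw [this, h, one_pow]

/-- The angle is not single-valued on the annulus, but the displacement `s = ϑ - φ` is: it solves `s
+ e sin(2φ + 2s) = 0`, whose coefficients `sin 2φ` and `cos 2φ` are polynomials in `cos φ` and `sin
φ`. -/
theorem unshiftAngle_shift {e : ℝ} (he : |e| < 1 / 2) (ϑ : ℝ) {φ : ℝ}
    (hφ : φ = ϑ + e * Real.sin (2 * ϑ)) :
    unshiftAngle (e, 2 * Real.sin φ * Real.cos φ, Real.cos φ ^ 2 - Real.sin φ ^ 2) = ϑ - φ := by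
  refine unshiftAngle_eq_of_angleEq (four_sq_mul_lt_one he
    (sq_two_mul_add_sq_sub (Real.cos_sq_add_sin_sq φ))) ?_
  simp only [angleEq]
  rw [← Real.sin_two_mul, ← Real.cos_two_mul', ← Real.sin_add]
  have : 2 * φ + 2 * (ϑ - φ) = 2 * ϑ := by ring
  rw [this]
  linarith

theorem analyticAt_unshiftAngle {e u v : ℝ} (he : |e| < 1 / 2) (huv : u ^ 2 + v ^ 2 = 1) :
    AnalyticAt ℝ unshiftAngle (e, u, v) := by
  have hlt := four_sq_mul_lt_one he huv
  obtain ⟨ϑ, -, hv, hu⟩ := exists_cos_sin (c := v) (s := u) (by linarith)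
  -- `u`, `v` are the sine and cosine of the doubled angle, so the point to be unshifted has angle
  -- `ϑ / 2`.
  obtain ⟨ψ, hψ⟩ := exists_shiftAngle_eq he (ϑ / 2)
  have h0 : angleEq ((e, u, v), ψ - ϑ / 2) = 0 := by
    simp only [angleEq]
    rw [hu, hv, ← Real.sin_add]
    have : ϑ + 2 * (ψ - ϑ / 2) = 2 * ψ := by ring
    rw [this]
    linarith
  have hg : AnalyticAt ℝ angleEq ((e, u, v), ψ - ϑ / 2) := by
    have : ContDiffAt ℝ ω angleEq ((e, u, v), ψ - ϑ / 2) := by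
      unfold angleEq
      fun_prop
    exact this.analyticAt
  refine analyticAt_of_implicit hg (hasDerivAt_angleEq _ _) (angleEq_deriv_pos hlt _).ne' h0 ?_
  have hc : Continuous fun z : (ℝ × ℝ × ℝ) × ℝ => 4 * z.1.1 ^ 2 * (z.1.2.1 ^ 2 + z.1.2.2 ^ 2) := by
    fun_prop
  filter_upwards [(hc.tendsto (((e, u, v), ψ - ϑ / 2))).eventually_lt_const hlt]
    with z hz hz0
  exact unshiftAngle_eq_of_angleEq hz hz0

/-! ### The elliptic shift and its inverse as jointly analytic families -/

/-- The cosine of the angular elliptic coordinate. -/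
noncomputable def cosCoord (p : ℝ × ℝ) : ℝ := p.1 * invChi (radial p)

/-- The sine of the angular elliptic coordinate. -/
noncomputable def sinCoord (p : ℝ × ℝ) : ℝ := p.2 * invEta (radial p)

/-- The point with radial coordinate `ρ` whose angular coordinate is that of `p` increased
by `d`. -/
noncomputable def relocate (ρ d : ℝ) (p : ℝ × ℝ) : ℝ × ℝ :=
  (chi ρ * (cosCoord p * Real.cos d - sinCoord p * Real.sin d),
    eta ρ * (sinCoord p * Real.cos d + cosCoord p * Real.sin d))

theorem cosCoord_ellipticPoint {ρ : ℝ} (hρ : ρ ∈ Set.Icc (1 : ℝ) 5) (ϑ : ℝ) :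
    cosCoord (ellipticPoint (ρ, ϑ)) = Real.cos ϑ := by
  rw [cosCoord, radial_ellipticPoint hρ, ellipticPoint]
  linear_combination Real.cos ϑ * chi_mul_invChi (Icc_subset_Ioo_domain hρ)

theorem sinCoord_ellipticPoint {ρ : ℝ} (hρ : ρ ∈ Set.Icc (1 : ℝ) 5) (ϑ : ℝ) :
    sinCoord (ellipticPoint (ρ, ϑ)) = Real.sin ϑ := by
  rw [sinCoord, radial_ellipticPoint hρ, ellipticPoint]
  linear_combination Real.sin ϑ * eta_mul_invEta (Icc_subset_Ioo_domain hρ)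

theorem relocate_ellipticPoint {ρ : ℝ} (hρ : ρ ∈ Set.Icc (1 : ℝ) 5) (ϑ ρ' d : ℝ) :
    relocate ρ' d (ellipticPoint (ρ, ϑ)) = ellipticPoint (ρ', ϑ + d) := by
  rw [relocate, cosCoord_ellipticPoint hρ, sinCoord_ellipticPoint hρ, ellipticPoint,
    Real.cos_add, Real.sin_add]

/-- The elliptic shift with parameters `ε`, as a function of the parameters and the point. -/
noncomputable def shiftMap (z : (ℝ × ℝ) × ℝ × ℝ) : ℝ × ℝ :=
  relocate (shiftRadial z.1.1 (radial z.2)) (z.1.2 * (2 * sinCoord z.2 * cosCoord z.2)) z.2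

/-- The inverse of the elliptic shift. -/
noncomputable def unshiftMap (z : (ℝ × ℝ) × ℝ × ℝ) : ℝ × ℝ :=
  relocate (unshiftRadial (z.1.1, radial z.2))
    (unshiftAngle (z.1.2, 2 * sinCoord z.2 * cosCoord z.2, cosCoord z.2 ^ 2 - sinCoord z.2 ^ 2))
    z.2

/-- The parameters for which the elliptic shift is a diffeomorphism of the annulus. -/
def Admissible (ε : ℝ × ℝ) : Prop := |ε.1| < 1 / 16 ∧ |ε.2| < 1 / 2

theorem shiftMap_ellipticPoint (ε : ℝ × ℝ) {ρ : ℝ} (hρ : ρ ∈ Set.Icc (1 : ℝ) 5) (ϑ : ℝ) :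
    shiftMap (ε, ellipticPoint (ρ, ϑ)) =
      ellipticPoint (shiftRadial ε.1 ρ, ϑ + ε.2 * Real.sin (2 * ϑ)) := by
  simp only [shiftMap]
  rw [relocate_ellipticPoint hρ, cosCoord_ellipticPoint hρ, sinCoord_ellipticPoint hρ,
    radial_ellipticPoint hρ, Real.sin_two_mul]

theorem unshiftMap_ellipticPoint {ε : ℝ × ℝ} (hε : Admissible ε) {ρ : ℝ}
    (hρ : ρ ∈ Set.Icc (1 : ℝ) 5) (ϑ : ℝ) :
    unshiftMap (ε, ellipticPoint (shiftRadial ε.1 ρ, ϑ + ε.2 * Real.sin (2 * ϑ))) =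
      ellipticPoint (ρ, ϑ) := by
  have hρ' := shiftRadial_mem hε.1 hρ
  simp only [unshiftMap]
  rw [relocate_ellipticPoint hρ', cosCoord_ellipticPoint hρ', sinCoord_ellipticPoint hρ',
    radial_ellipticPoint hρ', unshiftRadial_eq (injDomain_of_mem hε.1 hρ),
    unshiftAngle_shift hε.2 ϑ rfl]
  congr 2
  ring

theorem exists_shifted_ellipticPoint {ε : ℝ × ℝ} (hε : Admissible ε) {p : ℝ × ℝ}
    (hp : p ∈ annulus) : ∃ ρ ∈ Set.Icc (1 : ℝ) 5, ∃ ϑ,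
      ellipticPoint (shiftRadial ε.1 ρ, ϑ + ε.2 * Real.sin (2 * ϑ)) = p := by
  obtain ⟨ρ, hρ, ϑ, -, rfl⟩ := exists_ellipticPoint hp
  obtain ⟨t, ht, h1⟩ := exists_shiftRadial_eq ε.1 hρ
  obtain ⟨ψ, h2⟩ := exists_shiftAngle_eq hε.2 ϑ
  exact ⟨t, ht, ψ, by rw [h1, h2]⟩

theorem shiftMap_mem {ε : ℝ × ℝ} (hε : Admissible ε) {p : ℝ × ℝ} (hp : p ∈ annulus) :
    shiftMap (ε, p) ∈ annulus := by
  obtain ⟨ρ, hρ, ϑ, -, rfl⟩ := exists_ellipticPoint hp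
  rw [shiftMap_ellipticPoint ε hρ]
  exact ellipticPoint_mem (shiftRadial_mem hε.1 hρ) _

theorem unshiftMap_mem {ε : ℝ × ℝ} (hε : Admissible ε) {p : ℝ × ℝ} (hp : p ∈ annulus) :
    unshiftMap (ε, p) ∈ annulus := by
  obtain ⟨ρ, hρ, ϑ, rfl⟩ := exists_shifted_ellipticPoint hε hp
  rw [unshiftMap_ellipticPoint hε hρ]
  exact ellipticPoint_mem hρ _

theorem unshiftMap_shiftMap {ε : ℝ × ℝ} (hε : Admissible ε) {p : ℝ × ℝ} (hp : p ∈ annulus) :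
    unshiftMap (ε, shiftMap (ε, p)) = p := by
  obtain ⟨ρ, hρ, ϑ, -, rfl⟩ := exists_ellipticPoint hp
  rw [shiftMap_ellipticPoint ε hρ, unshiftMap_ellipticPoint hε hρ]

theorem shiftMap_unshiftMap {ε : ℝ × ℝ} (hε : Admissible ε) {p : ℝ × ℝ} (hp : p ∈ annulus) :
    shiftMap (ε, unshiftMap (ε, p)) = p := by
  obtain ⟨ρ, hρ, ϑ, rfl⟩ := exists_shifted_ellipticPoint hε hp
  rw [unshiftMap_ellipticPoint hε hρ, shiftMap_ellipticPoint ε hρ]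

/-- The elliptic shift as a bijection of the annulus. -/
noncomputable def shiftPerm (ε : ℝ × ℝ) (hε : Admissible ε) : Equiv.Perm annulus where
  toFun p := ⟨shiftMap (ε, p), shiftMap_mem hε p.2⟩
  invFun p := ⟨unshiftMap (ε, p), unshiftMap_mem hε p.2⟩
  left_inv p := Subtype.ext (unshiftMap_shiftMap hε p.2)
  right_inv p := Subtype.ext (shiftMap_unshiftMap hε p.2)

theorem isEllipticShift_shiftPerm (ε : ℝ × ℝ) (hε : Admissible ε) :
    IsEllipticShift ε.1 ε.2 (shiftPerm ε hε) := by
  intro p ρ ϑ hρ hp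
  change shiftMap (ε, p) = _
  rw [hp, shiftMap_ellipticPoint ε hρ]
  rfl

theorem IsEllipticShift.eq {ε₁ ε₂ : ℝ} {G G' : Equiv.Perm annulus}
    (hG : IsEllipticShift ε₁ ε₂ G) (hG' : IsEllipticShift ε₁ ε₂ G') : G = G' := by
  ext1 p
  obtain ⟨ρ, hρ, ϑ, -, h⟩ := exists_ellipticPoint p.2
  exact Subtype.ext ((hG p ρ ϑ hρ h.symm).trans (hG' p ρ ϑ hρ h.symm).symm)

theorem admissible_of_lt {ε₁ ε₂ : ℝ} (h₁ : 0 < ε₁) (h₁' : ε₁ < 1 / 16) (h₂ : 0 < ε₂)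
    (h₂' : ε₂ < 1 / 2) : Admissible (ε₁, ε₂) :=
  ⟨by rwa [abs_of_pos h₁], by rwa [abs_of_pos h₂]⟩

theorem admissible_zero : Admissible 0 := by
  constructor <;> simp

/-- The admissible parameters are star-shaped about `0`, so `t • ε` gives an isotopy from the
identity. -/
theorem Admissible.smul {ε : ℝ × ℝ} (hε : Admissible ε) {t : ℝ} (h0 : 0 ≤ t) (h1 : t ≤ 1) :
    Admissible (t • ε) := by
  constructor
  · have := mul_le_mul_of_nonneg_right h1 (abs_nonneg ε.1)
    simp only [Prod.smul_fst, smul_eq_mul, abs_mul, abs_of_nonneg h0]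
    linarith [hε.1]
  · have := mul_le_mul_of_nonneg_right h1 (abs_nonneg ε.2)
    simp only [Prod.smul_snd, smul_eq_mul, abs_mul, abs_of_nonneg h0]
    linarith [hε.2]

theorem cosCoord_sq_add_sinCoord_sq {p : ℝ × ℝ} (hp : p ∈ annulus) :
    cosCoord p ^ 2 + sinCoord p ^ 2 = 1 := by
  obtain ⟨ρ, hρ, ϑ, -, rfl⟩ := exists_ellipticPoint hp
  rw [cosCoord_ellipticPoint hρ, sinCoord_ellipticPoint hρ, Real.cos_sq_add_sin_sq]

theorem contDiffAt_chi {ρ : ℝ} (hρ : ρ ∈ Set.Icc (1 : ℝ) 5) : ContDiffAt ℝ ω chi ρ := by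
  have h : ρ + 1 ≠ 0 := by linarith [hρ.1]
  unfold chi
  fun_prop (disch := assumption)

theorem contDiffAt_eta {ρ : ℝ} (hρ : ρ ∈ Set.Icc (1 : ℝ) 5) : ContDiffAt ℝ ω eta ρ := by
  have h : 7 - ρ ≠ 0 := by linarith [hρ.2]
  unfold eta
  fun_prop (disch := assumption)

theorem contDiffAt_cosCoord {p : ℝ × ℝ} (hp : p ∈ annulus) : ContDiffAt ℝ ω cosCoord p := by
  have hr : ContDiffAt ℝ ω radial p := (analyticAt_radial hp).contDiffAt
  have h : 7 * radial p - 5 ≠ 0 := by linarith [(radial_mem hp).1]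
  unfold cosCoord invChi
  fun_prop (disch := assumption)

theorem contDiffAt_sinCoord {p : ℝ × ℝ} (hp : p ∈ annulus) : ContDiffAt ℝ ω sinCoord p := by
  have hr : ContDiffAt ℝ ω radial p := (analyticAt_radial hp).contDiffAt
  have h : radial p + 5 ≠ 0 := by linarith [(radial_mem hp).1]
  unfold sinCoord invEta
  fun_prop (disch := assumption)

theorem contDiffAt_relocate {E : Type*} [NormedAddCommGroup E] [NormedSpace ℝ E] {ρ d : E → ℝ}
    {q : E → ℝ × ℝ} {z : E} (hρ : ContDiffAt ℝ ω ρ z) (hd : ContDiffAt ℝ ω d z)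
    (hq : ContDiffAt ℝ ω q z) (hρz : ρ z ∈ Set.Icc (1 : ℝ) 5) (hqz : q z ∈ annulus) :
    ContDiffAt ℝ ω (fun x => relocate (ρ x) (d x) (q x)) z := by
  have h1 : ContDiffAt ℝ ω (fun x => chi (ρ x)) z := (contDiffAt_chi hρz).comp z hρ
  have h2 : ContDiffAt ℝ ω (fun x => eta (ρ x)) z := (contDiffAt_eta hρz).comp z hρ
  have h3 : ContDiffAt ℝ ω (fun x => cosCoord (q x)) z := (contDiffAt_cosCoord hqz).comp z hq
  have h4 : ContDiffAt ℝ ω (fun x => sinCoord (q x)) z := (contDiffAt_sinCoord hqz).comp z hq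
  unfold relocate
  fun_prop

theorem analyticAt_shiftMap {ε p : ℝ × ℝ} (hε : Admissible ε) (hp : p ∈ annulus) :
    AnalyticAt ℝ shiftMap (ε, p) := by
  have hr : ContDiffAt ℝ ω (fun z : (ℝ × ℝ) × ℝ × ℝ => radial z.2) (ε, p) :=
    ContDiffAt.comp (ε, p) (g := radial) (analyticAt_radial hp).contDiffAt contDiffAt_snd
  have hc : ContDiffAt ℝ ω (fun z : (ℝ × ℝ) × ℝ × ℝ => cosCoord z.2) (ε, p) :=
    ContDiffAt.comp (ε, p) (g := cosCoord) (contDiffAt_cosCoord hp) contDiffAt_snd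
  have hs : ContDiffAt ℝ ω (fun z : (ℝ × ℝ) × ℝ × ℝ => sinCoord z.2) (ε, p) :=
    ContDiffAt.comp (ε, p) (g := sinCoord) (contDiffAt_sinCoord hp) contDiffAt_snd
  have : ContDiffAt ℝ ω shiftMap (ε, p) := by
    refine contDiffAt_relocate ?_ ?_ contDiffAt_snd
      (shiftRadial_mem hε.1 (radial_mem hp)) hp
    · unfold shiftRadial P
      fun_prop
    · fun_prop
  exact this.analyticAt

theorem unshiftRadial_mem {e ρ : ℝ} (he : |e| < 1 / 16) (hρ : ρ ∈ Set.Icc (1 : ℝ) 5) :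
    unshiftRadial (e, ρ) ∈ Set.Icc (1 : ℝ) 5 := by
  obtain ⟨t, ht, rfl⟩ := exists_shiftRadial_eq e hρ
  rwa [unshiftRadial_eq (injDomain_of_mem he ht)]

theorem analyticAt_unshiftMap {ε p : ℝ × ℝ} (hε : Admissible ε) (hp : p ∈ annulus) :
    AnalyticAt ℝ unshiftMap (ε, p) := by
  have hr : ContDiffAt ℝ ω (fun z : (ℝ × ℝ) × ℝ × ℝ => radial z.2) (ε, p) :=
    ContDiffAt.comp (ε, p) (g := radial) (analyticAt_radial hp).contDiffAt contDiffAt_snd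
  have hc : ContDiffAt ℝ ω (fun z : (ℝ × ℝ) × ℝ × ℝ => cosCoord z.2) (ε, p) :=
    ContDiffAt.comp (ε, p) (g := cosCoord) (contDiffAt_cosCoord hp) contDiffAt_snd
  have hs : ContDiffAt ℝ ω (fun z : (ℝ × ℝ) × ℝ × ℝ => sinCoord z.2) (ε, p) :=
    ContDiffAt.comp (ε, p) (g := sinCoord) (contDiffAt_sinCoord hp) contDiffAt_snd
  have hu := sq_two_mul_add_sq_sub (cosCoord_sq_add_sinCoord_sq hp)
  have : ContDiffAt ℝ ω unshiftMap (ε, p) := by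
    refine contDiffAt_relocate ?_ ?_ contDiffAt_snd
      (unshiftRadial_mem hε.1 (radial_mem hp)) hp
    · exact ContDiffAt.comp (ε, p) (g := unshiftRadial)
        (f := fun z : (ℝ × ℝ) × ℝ × ℝ => (z.1.1, radial z.2))
        (analyticAt_unshiftRadial hε.1 (radial_mem hp)).contDiffAt (by fun_prop)
    · exact ContDiffAt.comp (ε, p) (g := unshiftAngle)
        (f := fun z : (ℝ × ℝ) × ℝ × ℝ => (z.1.2, 2 * sinCoord z.2 * cosCoord z.2,
          cosCoord z.2 ^ 2 - sinCoord z.2 ^ 2))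
        (analyticAt_unshiftAngle hε.2 hu).contDiffAt (by fun_prop)
  exact this.analyticAt

/-! ### Analytic diffeomorphisms and closeness -/

theorem IsAnalyticExtension.comp {F H : ℝ × ℝ → ℝ × ℝ} {f h : annulus → annulus}
    (hF : IsAnalyticExtension F f) (hH : IsAnalyticExtension H h) :
    IsAnalyticExtension (F ∘ H) (f ∘ h) := by
  refine ⟨fun p hp => ?_, fun p => ?_⟩
  · refine AnalyticAt.comp ?_ (hH.1 p hp)
    rw [hH.2 ⟨p, hp⟩]
    exact hF.1 _ (h ⟨p, hp⟩).2
  · rw [Function.comp_apply, hH.2, hF.2, Function.comp_apply]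

theorem IsAnalyticDiffeo.mul {A B : Equiv.Perm annulus} (hA : IsAnalyticDiffeo A)
    (hB : IsAnalyticDiffeo B) : IsAnalyticDiffeo (A * B) := by
  obtain ⟨⟨F, hF⟩, F', hF'⟩ := hA
  obtain ⟨⟨H, hH⟩, H', hH'⟩ := hB
  exact ⟨⟨F ∘ H, hF.comp hH⟩, H' ∘ F', hH'.comp hF'⟩

theorem IsAnalyticDiffeo.inv {A : Equiv.Perm annulus} (hA : IsAnalyticDiffeo A) :
    IsAnalyticDiffeo A⁻¹ :=
  ⟨hA.2, hA.1⟩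

theorem analyticOnNhd_planeRotation : AnalyticOnNhd ℝ planeRotation annulus := by
  intro p _
  have : ContDiffAt ℝ ω (fun p : ℝ × ℝ => (-p.2, p.1)) p := by fun_prop
  exact this.analyticAt

theorem isAnalyticDiffeo_rotation : IsAnalyticDiffeo rotation := by
  refine ⟨⟨planeRotation, analyticOnNhd_planeRotation, fun p => rfl⟩,
    planeRotation.symm, fun p _ => ?_, fun p => rfl⟩
  have : ContDiffAt ℝ ω (fun p : ℝ × ℝ => (p.2, -p.1)) p := by fun_prop
  exact this.analyticAt

theorem analyticAt_slice {E F Q : Type*} [NormedAddCommGroup E] [NormedSpace ℝ E]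
    [NormedAddCommGroup F] [NormedSpace ℝ F] [NormedAddCommGroup Q] [NormedSpace ℝ Q]
    {J : Q × E → F} {ε : Q} {p : E} (hJ : AnalyticAt ℝ J (ε, p)) :
    AnalyticAt ℝ (fun q => J (ε, q)) p :=
  AnalyticAt.fun_comp (g := J) (f := fun q : E => (ε, q)) hJ (analyticAt_const.prod analyticAt_id)

theorem isAnalyticDiffeo_shiftPerm (ε : ℝ × ℝ) (hε : Admissible ε) :
    IsAnalyticDiffeo (shiftPerm ε hε) :=
  ⟨⟨fun p => shiftMap (ε, p), fun _ hp => analyticAt_slice (analyticAt_shiftMap hε hp),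
    fun _ => rfl⟩, fun p => unshiftMap (ε, p),
    fun _ hp => analyticAt_slice (analyticAt_unshiftMap hε hp), fun _ => rfl⟩

theorem isCompact_annulus : IsCompact annulus := by
  refine Metric.isCompact_of_isClosed_isBounded ?_ ?_
  · have hc : Continuous fun p : ℝ × ℝ => p.1 ^ 2 + p.2 ^ 2 := by fun_prop
    exact (isClosed_le continuous_const hc).inter (isClosed_le hc continuous_const)
  · refine (Metric.isBounded_iff_subset_closedBall 0).2 ⟨5, fun p hp => ?_⟩
    rw [mem_closedBall_zero_iff, Prod.norm_def, max_le_iff]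
    have := hp.2
    constructor <;> refine abs_le_of_sq_le_sq ?_ (by norm_num) <;> nlinarith [sq_nonneg p.1,
      sq_nonneg p.2]

/-- A jointly analytic family of self-maps of the annulus is `C^k`-continuous at the parameter
zero. -/
theorem eventually_ckClose {J : (ℝ × ℝ) × ℝ × ℝ → ℝ × ℝ} {f : annulus → annulus}
    (hJ : ∀ ε, Admissible ε → ∀ p ∈ annulus, AnalyticAt ℝ J (ε, p))
    (hf : ∀ p : annulus, J (0, p) = f p) (k : ℕ) {r : ℝ} (hr : 0 < r) :
    ∀ᶠ ε in 𝓝 (0 : ℝ × ℝ), Admissible ε → ∀ g : annulus → annulus,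
      (∀ p : annulus, J (ε, p) = g p) → CkClose k r g f := by
  filter_upwards [eventually_iteratedFDeriv_slice_sub_lt isCompact_annulus
    (fun p hp => hJ 0 admissible_zero p hp) k hr] with ε hε hadm g hg
  exact ⟨fun q => J (ε, q), fun q => J (0, q),
    ⟨fun p hp => analyticAt_slice (hJ ε hadm p hp), hg⟩,
    ⟨fun p hp => analyticAt_slice (hJ 0 admissible_zero p hp), hf⟩, hε⟩

theorem shiftMap_zero {p : ℝ × ℝ} (hp : p ∈ annulus) : shiftMap (0, p) = p := by
  obtain ⟨ρ, hρ, ϑ, -, rfl⟩ := exists_ellipticPoint hp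
  rw [shiftMap_ellipticPoint 0 hρ]
  simp [shiftRadial]

theorem unshiftMap_zero {p : ℝ × ℝ} (hp : p ∈ annulus) : unshiftMap (0, p) = p := by
  have := unshiftMap_shiftMap admissible_zero hp
  rwa [shiftMap_zero hp] at this

/-- The conjugated rotations again form a jointly analytic family, with the rotation at parameter
`0`, so `eventually_ckClose` applies to them. -/
theorem analyticAt_conjugate {ε p : ℝ × ℝ} (hε : Admissible ε) (hp : p ∈ annulus) :
    AnalyticAt ℝ (fun z : (ℝ × ℝ) × ℝ × ℝ => shiftMap (z.1, planeRotation (unshiftMap z)))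
      (ε, p) := by
  have h1 := unshiftMap_mem hε hp
  have h2 : planeRotation (unshiftMap (ε, p)) ∈ annulus := (rotation ⟨_, h1⟩).2
  refine AnalyticAt.fun_comp (g := shiftMap)
    (f := fun z : (ℝ × ℝ) × ℝ × ℝ => (z.1, planeRotation (unshiftMap z)))
    (analyticAt_shiftMap hε h2) (analyticAt_fst.prod ?_)
  exact AnalyticAt.fun_comp (g := planeRotation) (analyticOnNhd_planeRotation _ h1)
    (analyticAt_unshiftMap hε hp)

theorem exists_ckClose (k : ℕ) {r : ℝ} (hr : 0 < r) : ∃ ε₀ : ℝ, 0 < ε₀ ∧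
    ∀ ε : ℝ × ℝ, |ε.1| < ε₀ → |ε.2| < ε₀ → ∀ hε : Admissible ε,
      CkClose k r (shiftPerm ε hε) id ∧
      CkClose k r (shiftPerm ε hε * rotation * (shiftPerm ε hε)⁻¹ : Equiv.Perm annulus)
        rotation := by
  have h1 := eventually_ckClose (J := shiftMap) (f := id)
    (fun ε hε p hp => analyticAt_shiftMap hε hp) (fun p => shiftMap_zero p.2) k hr
  have h2 := eventually_ckClose (f := rotation)
    (fun ε hε p hp => analyticAt_conjugate hε hp)
    (fun p => by
      rw [unshiftMap_zero p.2, planeRotation_coe, shiftMap_zero (rotation p).2]) k hr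
  obtain ⟨ε₀, hε₀, h⟩ := Metric.eventually_nhds_iff.1 (h1.and h2)
  refine ⟨ε₀, hε₀, fun ε he1 he2 hε => ?_⟩
  have hd : dist ε 0 < ε₀ := by
    rw [dist_zero_right, Prod.norm_def]
    exact max_lt he1 he2
  exact ⟨(h hd).1 hε _ fun p => rfl, (h hd).2 hε _ fun p => rfl⟩

/-! ### Essential curves -/

/-- A bijection of the annulus which is a member of an analytic family of self-maps starting at
the identity preserves essential curves. -/
theorem IsEssentialCurve.image {J : (ℝ × ℝ) × ℝ × ℝ → ℝ × ℝ}
    (hJ : ∀ ε, Admissible ε → ∀ p ∈ annulus, AnalyticAt ℝ J (ε, p))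
    (hmem : ∀ ε, Admissible ε → ∀ p ∈ annulus, J (ε, p) ∈ annulus)
    (h0 : ∀ p ∈ annulus, J (0, p) = p) {ε : ℝ × ℝ} (hε : Admissible ε)
    {A : Equiv.Perm annulus} (hA : ∀ p : annulus, J (ε, p) = A p) {K : Set annulus}
    (hK : IsEssentialCurve K) : IsEssentialCurve (A '' K) := by
  obtain ⟨c, hinj, hc, rfl⟩ := hK
  have hadm : ∀ t : unitInterval, Admissible ((t : ℝ) • ε) := fun t => hε.smul t.2.1 t.2.2
  have hcont : Continuous fun z : unitInterval × annulus => J ((z.1 : ℝ) • ε, z.2) := by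
    refine continuous_iff_continuousAt.2 fun z => ?_
    refine ContinuousAt.comp (g := J)
      (f := fun z : unitInterval × annulus => ((z.1 : ℝ) • ε, (z.2 : ℝ × ℝ)))
      (hJ _ (hadm z.1) _ z.2.2).continuousAt ?_
    fun_prop
  have hAc : Continuous A := by
    refine continuous_induced_rng.2 ?_
    have : (Subtype.val ∘ A : annulus → ℝ × ℝ) = fun p : annulus => J (((1 : unitInterval) : ℝ) • ε, p) := by
      funext p
      simp [hA]
    rw [this]
    exact hcont.comp (continuous_const.prodMk continuous_id)
  have hhom : (ContinuousMap.id annulus).Homotopic ⟨A, hAc⟩ :=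
    ⟨{ toFun := fun z => ⟨J ((z.1 : ℝ) • ε, z.2), hmem _ (hadm z.1) _ z.2.2⟩
       continuous_toFun := hcont.subtype_mk _
       map_zero_left := fun p => Subtype.ext (by simp [h0 _ p.2])
       map_one_left := fun p => Subtype.ext (by simp [hA]) }⟩
  refine ⟨(⟨A, hAc⟩ : C(annulus, annulus)).comp c, A.injective.comp hinj, ?_, ?_⟩
  · have := hhom.symm.comp (ContinuousMap.Homotopic.refl c)
    rw [ContinuousMap.id_comp] at this
    exact this.trans hc
  · rw [ContinuousMap.coe_comp, Set.range_comp]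
    rfl

theorem IsEssentialCurve.shift_image {ε : ℝ × ℝ} (hε : Admissible ε) {K : Set annulus}
    (hK : IsEssentialCurve K) : IsEssentialCurve (shiftPerm ε hε '' K) :=
  hK.image (J := shiftMap) (fun _ h _ hp => analyticAt_shiftMap h hp)
    (fun _ h _ hp => shiftMap_mem h hp) (fun _ hp => shiftMap_zero hp) hε fun _ => rfl

theorem IsEssentialCurve.shift_inv_image {ε : ℝ × ℝ} (hε : Admissible ε) {K : Set annulus}
    (hK : IsEssentialCurve K) : IsEssentialCurve (((shiftPerm ε hε)⁻¹ : Equiv.Perm annulus) '' K) :=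
  hK.image (J := unshiftMap) (fun _ h _ hp => analyticAt_unshiftMap h hp)
    (fun _ h _ hp => unshiftMap_mem h hp) (fun _ hp => unshiftMap_zero hp) hε fun _ => rfl

theorem circle_re_sq_add_im_sq (z : Circle) : (z : ℂ).re ^ 2 + (z : ℂ).im ^ 2 = 1 := by
  have h := Circle.normSq_coe z
  rw [Complex.normSq_apply] at h
  linarith

/-- The standard parametrization of the ellipse with semiaxes `a` and `b`. -/
noncomputable def ellipseCurve (a b : ℝ) (ha : a ∈ Set.Icc (1 : ℝ) 5)
    (hb : b ∈ Set.Icc (1 : ℝ) 5) : C(Circle, annulus) where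
  toFun z := ⟨(a * (z : ℂ).re, b * (z : ℂ).im),
    mem_annulus_of_semiaxes ha hb (circle_re_sq_add_im_sq z)⟩
  continuous_toFun := by
    refine Continuous.subtype_mk ?_ _
    exact (continuous_const.mul (Complex.continuous_re.comp continuous_subtype_val)).prodMk
      (continuous_const.mul (Complex.continuous_im.comp continuous_subtype_val))

theorem isEssentialCurve_ellipse {a b : ℝ} (ha : a ∈ Set.Icc (1 : ℝ) 5)
    (hb : b ∈ Set.Icc (1 : ℝ) 5) :
    IsEssentialCurve {p | (p : ℝ × ℝ).1 ^ 2 / a ^ 2 + (p : ℝ × ℝ).2 ^ 2 / b ^ 2 = 1} := by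
  have ha0 : a ≠ 0 := by linarith [ha.1]
  have hb0 : b ≠ 0 := by linarith [hb.1]
  have h3 : (3 : ℝ) ∈ Set.Icc (1 : ℝ) 5 := by norm_num
  -- Both semiaxes are deformed linearly to `3`; convexity of `[1, 5]` keeps the ellipses in the
  -- annulus.
  have hseg : ∀ x ∈ Set.Icc (1 : ℝ) 5, ∀ t : unitInterval,
      (1 - (t : ℝ)) * x + t * 3 ∈ Set.Icc (1 : ℝ) 5 := fun x hx t =>
    convex_Icc (1 : ℝ) 5 hx h3 (by linarith [t.2.2]) t.2.1 (by ring)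
  refine ⟨ellipseCurve a b ha hb, ?_, ⟨?_⟩, ?_⟩
  · intro z w h
    have h' := congrArg Subtype.val h
    simp only [ellipseCurve, ContinuousMap.coe_mk, Prod.mk.injEq] at h'
    exact Circle.ext (Complex.ext (mul_left_cancel₀ ha0 h'.1) (mul_left_cancel₀ hb0 h'.2))
  · exact
      { toFun := fun z => ⟨(((1 - (z.1 : ℝ)) * a + z.1 * 3) * (z.2 : ℂ).re,
          ((1 - (z.1 : ℝ)) * b + z.1 * 3) * (z.2 : ℂ).im),
          mem_annulus_of_semiaxes (hseg a ha z.1) (hseg b hb z.1) (circle_re_sq_add_im_sq z.2)⟩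
        continuous_toFun := by
          refine Continuous.subtype_mk ?_ _
          have h1 : Continuous fun z : unitInterval × Circle => ((z.2 : Circle) : ℂ) :=
            continuous_subtype_val.comp continuous_snd
          have h2 : Continuous fun z : unitInterval × Circle => (z.2 : ℂ).re :=
            Complex.continuous_re.comp h1
          have h3 : Continuous fun z : unitInterval × Circle => (z.2 : ℂ).im :=
            Complex.continuous_im.comp h1
          fun_prop
        map_zero_left := fun z => by simp [ellipseCurve]
        map_one_left := fun z => by simp [coreCircle] }
  · ext p
    constructor
    · rintro ⟨z, rfl⟩
      have h := circle_re_sq_add_im_sq z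
      simp only [ellipseCurve, ContinuousMap.coe_mk, Set.mem_ofPred_eq, mul_pow]
      field_simp
      exact h
    · intro hp
      obtain ⟨⟨x, y⟩, hxy⟩ := p
      simp only [Set.mem_ofPred_eq] at hp
      have hz : (⟨x / a, y / b⟩ : ℂ) ∈ Submonoid.unitSphere ℂ := by
        rw [Submonoid.unitSphere, Submonoid.mem_mk, Subsemigroup.mem_mk, mem_sphere_zero_iff_norm, ← sq_eq_sq₀ (norm_nonneg _) zero_le_one, Complex.sq_norm,
          Complex.normSq_mk, one_pow, ← hp]
        ring
      refine ⟨⟨⟨x / a, y / b⟩, hz⟩, Subtype.ext ?_⟩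
      simp only [ellipseCurve, ContinuousMap.coe_mk]
      rw [mul_div_cancel₀ _ ha0, mul_div_cancel₀ _ hb0]

/-! ### Inside and outside of ellipses -/

theorem isBounded_of_gauge_lt {a b : ℝ} (ha : a ∈ Set.Icc (1 : ℝ) 25)
    (hb : b ∈ Set.Icc (1 : ℝ) 25) :
    Bornology.IsBounded {p : ℝ × ℝ | p.1 ^ 2 / a + p.2 ^ 2 / b < 1} := by
  have ha0 : 0 < a := by linarith [ha.1]
  have hb0 : 0 < b := by linarith [hb.1]
  refine (Metric.isBounded_iff_subset_closedBall 0).2 ⟨5, fun p hp => ?_⟩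
  rw [Set.mem_ofPred_eq] at hp
  have h1 : 0 ≤ p.1 ^ 2 / a := by positivity
  have h2 : 0 ≤ p.2 ^ 2 / b := by positivity
  have h3 : p.1 ^ 2 < a := (div_lt_one ha0).1 (by linarith)
  have h4 : p.2 ^ 2 < b := (div_lt_one hb0).1 (by linarith)
  rw [mem_closedBall_zero_iff, Prod.norm_def, max_le_iff]
  constructor <;> refine abs_le_of_sq_le_sq ?_ (by norm_num)
  · linarith [ha.2]
  · linarith [hb.2]

/-- A connected set leaving `{gauge < 1}` must cross `{gauge = 1}`. With `a, b ∈ [1, 25]` that whole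
ellipse lies in the annulus, so the crossing point is on the curve. -/
theorem strictlyInside_of_gauge_lt {a b : ℝ} (ha : a ∈ Set.Icc (1 : ℝ) 25)
    (hb : b ∈ Set.Icc (1 : ℝ) 25) {C : Set annulus}
    (hC : ∀ p ∈ C, (p : ℝ × ℝ).1 ^ 2 / a + (p : ℝ × ℝ).2 ^ 2 / b < 1) :
    StrictlyInside C {p : annulus | (p : ℝ × ℝ).1 ^ 2 / a + (p : ℝ × ℝ).2 ^ 2 / b = 1} := by
  intro p hp
  have ha0 : 0 < a := by linarith [ha.1]
  have hb0 : 0 < b := by linarith [hb.1]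
  set K : Set annulus := {p : annulus | (p : ℝ × ℝ).1 ^ 2 / a + (p : ℝ × ℝ).2 ^ 2 / b = 1} with hK
  have hpK : p ∉ K := (hC p hp).ne
  refine ⟨hpK, (isBounded_of_gauge_lt ha hb).subset fun y hy => ?_⟩
  by_contra hcon
  rw [Set.mem_ofPred_eq, not_lt] at hcon
  have hpc : (p : ℝ × ℝ) ∈ (Subtype.val '' K)ᶜ := by
    rintro ⟨q, hq, hqp⟩
    exact hpK (Subtype.ext hqp ▸ hq)
  have hcont : Continuous fun q : ℝ × ℝ => q.1 ^ 2 / a + q.2 ^ 2 / b := by fun_prop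
  obtain ⟨z, hz, hz1⟩ := isPreconnected_connectedComponentIn.intermediate_value
    (mem_connectedComponentIn hpc) hy hcont.continuousOn ⟨(hC p hp).le, hcon⟩
  simp only at hz1
  have hzann : z ∈ annulus := by
    have h1 : z.1 ^ 2 = a * (z.1 ^ 2 / a) := by field_simp
    have h2 : z.2 ^ 2 = b * (z.2 ^ 2 / b) := by field_simp
    have h3 : 0 ≤ z.1 ^ 2 / a := by positivity
    have h4 : 0 ≤ z.2 ^ 2 / b := by positivity
    have h5 := ha.1
    have h6 := ha.2
    have h7 := hb.1
    have h8 := hb.2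
    constructor <;> rw [h1, h2] <;> nlinarith
  exact connectedComponentIn_subset _ _ hz ⟨⟨z, hzann⟩, hz1, rfl⟩

/-- The outward ray from `p` is unbounded and avoids `K`, since the gauge does not decrease along
it. -/
theorem strictlyOutside_of_gauge_lt {a b : ℝ} {C K : Set annulus}
    (hC : ∀ p ∈ C, 1 ≤ (p : ℝ × ℝ).1 ^ 2 / a + (p : ℝ × ℝ).2 ^ 2 / b)
    (hK : ∀ p ∈ K, (p : ℝ × ℝ).1 ^ 2 / a + (p : ℝ × ℝ).2 ^ 2 / b < 1) :
    StrictlyOutside C K := by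
  intro p hp
  refine ⟨fun hpK => (hK p hpK).not_ge (hC p hp), fun hbdd => ?_⟩
  have hray : IsPreconnected ((fun t : ℝ => t • (p : ℝ × ℝ)) '' Set.Ici 1) :=
    isPreconnected_Ici.image _ (by fun_prop)
  have hsub := hray.subset_connectedComponentIn (x := (p : ℝ × ℝ))
    (F := (Subtype.val '' K)ᶜ) ⟨1, by simp, by simp⟩ (by
      rintro _ ⟨t, ht, rfl⟩ ⟨q, hq, hqt⟩
      have h1 := hK q hq
      have h2 := hC p hp
      rw [hqt] at h1
      simp only [Prod.smul_fst, Prod.smul_snd, smul_eq_mul, mul_pow, mul_div_assoc] at h1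
      have ht' : (1 : ℝ) ≤ t := ht
      have h3 : 1 ≤ t ^ 2 := by nlinarith
      nlinarith)
  obtain ⟨R, hR⟩ := (Metric.isBounded_iff_subset_closedBall 0).1 (hbdd.subset hsub)
  have hp0 : 0 < ‖(p : ℝ × ℝ)‖ := norm_pos_iff.2 (ne_zero_of_mem_annulus p.2)
  set t := max 1 ((R + 1) / ‖(p : ℝ × ℝ)‖) with ht
  have h1 := hR ⟨t, Set.mem_Ici.2 (le_max_left _ _), rfl⟩
  simp only [mem_closedBall_zero_iff, norm_smul, Real.norm_eq_abs] at h1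
  have h2 : (R + 1) / ‖(p : ℝ × ℝ)‖ ≤ |t| := (le_max_right _ _).trans (le_abs_self _)
  rw [div_le_iff₀ hp0] at h2
  linarith

/-! ### The shift pushes the ellipse inwards -/

/-- With `b = e sin w` the difference of cosines is `2 sin b · sin(w + b)`, and `|sin b| ≤ |b| <
|sin w| / 2 < |sin w| cos b` gives `sin(w + b)` the sign of `sin w`, which is that of `sin b`. -/
theorem cos_add_mul_sin_lt {e w : ℝ} (he0 : 0 < e) (he : e < 1 / 2) (hw : Real.sin w ≠ 0) :
    Real.cos (w + 2 * (e * Real.sin w)) < Real.cos w := by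
  set b := e * Real.sin w with hb
  have habs : |b| = e * |Real.sin w| := by rw [hb, abs_mul, abs_of_pos he0]
  have hw0 : 0 < |Real.sin w| := abs_pos.2 hw
  have hw1 := Real.abs_sin_le_one w
  have hb0 : 0 < |b| := by rw [habs]; positivity
  have hb1 : |b| < 1 / 2 := by rw [habs]; nlinarith
  have hbw : |b| < |Real.sin w| / 2 := by rw [habs]; nlinarith
  have hsinb : |Real.sin b| ≤ |b| := Real.abs_sin_le_abs
  have hcosb : 1 / 2 < Real.cos b := by
    have h1 := Real.one_sub_sq_div_two_le_cos (x := b)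
    have h2 : b ^ 2 < 1 / 4 := by
      rw [← sq_abs]
      nlinarith
    linarith
  have hpos : 0 < Real.sin w * Real.sin b := by
    obtain ⟨hb2, hb3⟩ := abs_lt.1 hb1
    have hpi := Real.pi_gt_three
    rcases lt_or_gt_of_ne hw with h | h
    · have : Real.sin b < 0 :=
        Real.sin_neg_of_neg_of_neg_pi_lt (mul_neg_of_pos_of_neg he0 h) (by linarith)
      exact mul_pos_of_neg_of_neg h this
    · exact mul_pos h (Real.sin_pos_of_pos_of_lt_pi (mul_pos he0 h) (by linarith))
  have hsb0 : 0 < |Real.sin b| := by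
    refine abs_pos.2 fun h => ?_
    rw [h, mul_zero] at hpos
    exact hpos.false
  have hprod : Real.sin w * Real.sin b = |Real.sin w| * |Real.sin b| := by
    rw [← abs_mul, abs_of_pos hpos]
  have hsq : Real.sin b ^ 2 = |Real.sin b| ^ 2 := (sq_abs _).symm
  have hexp : Real.cos w - Real.cos (w + 2 * b) =
      2 * (Real.sin w * Real.sin b * Real.cos b + Real.cos w * Real.sin b ^ 2) := by
    rw [Real.cos_add, Real.cos_two_mul, Real.sin_two_mul]
    linear_combination (-2 * Real.cos w) * Real.sin_sq_add_cos_sq b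
  have hlow : 0 < Real.sin w * Real.sin b * Real.cos b + Real.cos w * Real.sin b ^ 2 := by
    have h1 : -|Real.sin b| ^ 2 ≤ Real.cos w * Real.sin b ^ 2 := by
      rw [hsq]
      nlinarith [Real.neg_one_le_cos w, sq_nonneg |Real.sin b|]
    have h2 : 0 < |Real.sin b| * (|Real.sin w| * Real.cos b - |Real.sin b|) := by
      refine mul_pos hsb0 ?_
      nlinarith
    rw [hprod]
    nlinarith
  linarith

theorem cos_sq_shift_lt {e ϑ : ℝ} (he0 : 0 < e) (he : e < 1 / 2) (h : Real.sin (2 * ϑ) ≠ 0) :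
    Real.cos (ϑ + e * Real.sin (2 * ϑ)) ^ 2 < Real.cos ϑ ^ 2 := by
  rw [Real.cos_sq, Real.cos_sq ϑ, mul_add]
  linarith [cos_add_mul_sin_lt he0 he h]

theorem cos_sq_shift_le {e : ℝ} (he0 : 0 < e) (he : e < 1 / 2) (ϑ : ℝ) :
    Real.cos (ϑ + e * Real.sin (2 * ϑ)) ^ 2 ≤ Real.cos ϑ ^ 2 := by
  by_cases h : Real.sin (2 * ϑ) = 0
  · rw [h, mul_zero, add_zero]
  · exact (cos_sq_shift_lt he0 he h).le

theorem eta_lt_two_mul_chi {ρ : ℝ} (hρ : ρ ∈ Set.Icc (1 : ℝ) 5) : eta ρ < 2 * chi ρ := by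
  have h1 : 0 < ρ + 1 := by linarith [hρ.1]
  have h2 : 0 < 7 - ρ := by linarith [hρ.2]
  rw [chi, eta, ← mul_div_assoc, div_lt_div_iff₀ h2 h1]
  -- The cross-multiplied difference is `15(ρ - 1)(5 - ρ) + 12ρ`.
  nlinarith [mul_nonneg (sub_nonneg.2 hρ.1) (sub_nonneg.2 hρ.2)]

/-- In elliptic coordinates the gauge is `χ² cos² ϑ / 4 + η² sin² ϑ / 16`, which increases with `ρ`
and, as `η < 2χ`, with `cos² ϑ`. Neither part of the shift raises it, and one of them lowers it
strictly. -/
theorem shift_gauge_lt {ε : ℝ × ℝ} (hε : Admissible ε) (h1 : 0 < ε.1) (h2 : 0 < ε.2)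
    {p : annulus} (hp : p ∈ ellipse) :
    (shiftPerm ε hε p : ℝ × ℝ).1 ^ 2 / 4 + (shiftPerm ε hε p : ℝ × ℝ).2 ^ 2 / 16 < 1 := by
  obtain ⟨ρ, hρ, ϑ, -, h⟩ := exists_ellipticPoint p.2
  have hG := isEllipticShift_shiftPerm ε hε p ρ ϑ hρ h.symm
  rw [hG]
  have hp' : chi ρ ^ 2 * Real.cos ϑ ^ 2 / 4 + eta ρ ^ 2 * Real.sin ϑ ^ 2 / 16 = 1 := by
    have h3 : (p : ℝ × ℝ).1 ^ 2 / 4 + (p : ℝ × ℝ).2 ^ 2 / 16 = 1 := hp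
    rw [← h] at h3
    simpa [ellipticPoint, mul_pow] using h3
  simp only [ellipticPoint, mul_pow]
  have hρ' : ρ + ε.1 * P ρ ∈ Set.Icc (1 : ℝ) 5 := shiftRadial_mem hε.1 hρ
  have he2 : ε.2 < 1 / 2 := (abs_lt.1 hε.2).2
  set ρ' := ρ + ε.1 * P ρ with hρ'def
  set φ := ϑ + ε.2 * Real.sin (2 * ϑ) with hφ
  have hχ0 := (chi_mem_Icc hρ').1
  have hη0 := (eta_mem_Icc hρ').1
  have hcoef : 0 < chi ρ' ^ 2 / 4 - eta ρ' ^ 2 / 16 := by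
    nlinarith [eta_lt_two_mul_chi hρ']
  have hsplit : ∀ ψ, chi ρ' ^ 2 * Real.cos ψ ^ 2 / 4 + eta ρ' ^ 2 * Real.sin ψ ^ 2 / 16 =
      (chi ρ' ^ 2 / 4 - eta ρ' ^ 2 / 16) * Real.cos ψ ^ 2 + eta ρ' ^ 2 / 16 := fun ψ => by
    rw [Real.sin_sq]
    ring
  have hang : chi ρ' ^ 2 * Real.cos φ ^ 2 / 4 + eta ρ' ^ 2 * Real.sin φ ^ 2 / 16 ≤
      chi ρ' ^ 2 * Real.cos ϑ ^ 2 / 4 + eta ρ' ^ 2 * Real.sin ϑ ^ 2 / 16 := by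
    rw [hsplit, hsplit]
    have := mul_le_mul_of_nonneg_left (cos_sq_shift_le h2 he2 ϑ) hcoef.le
    linarith
  have hcs := Real.cos_sq_add_sin_sq ϑ
  by_cases h3 : ρ = 3
  · have hρ3 : ρ' = ρ := by rw [hρ'def, h3, P]; ring
    -- At `ρ = 3` the condition reads `4 cos² ϑ + sin² ϑ / 4 = 1`, which fails on the axes.
    have hsin : Real.sin (2 * ϑ) ≠ 0 := by
      rw [Real.sin_two_mul]
      have hχ3 : chi 3 = 4 := by norm_num [chi]
      have hη3 : eta 3 = 2 := by norm_num [eta]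
      rw [h3, hχ3, hη3] at hp'
      intro h0
      rcases mul_eq_zero.1 h0 with h0 | h0
      · have hs : Real.sin ϑ = 0 := by linarith
        rw [hs] at hp' hcs
        linarith
      · rw [h0] at hp' hcs
        linarith
    rw [← hp', ← hρ3, hsplit, hsplit]
    have := mul_lt_mul_of_pos_left (cos_sq_shift_lt h2 he2 hsin) hcoef
    linarith
  · have hne1 : ρ ≠ 1 := by
      rintro rfl
      have hχ1 : chi 1 = 1 := by norm_num [chi]
      have hη1 : eta 1 = 1 := by norm_num [eta]
      rw [hχ1, hη1] at hp'
      linarith [sq_nonneg (Real.cos ϑ), sq_nonneg (Real.sin ϑ)]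
    have hne5 : ρ ≠ 5 := by
      rintro rfl
      have hχ5 : chi 5 = 5 := by norm_num [chi]
      have hη5 : eta 5 = 5 := by norm_num [eta]
      rw [hχ5, hη5] at hp'
      linarith [sq_nonneg (Real.cos ϑ), sq_nonneg (Real.sin ϑ)]
    have hPneg : P ρ < 0 := by
      have ha : 0 < ρ - 1 := sub_pos.2 (lt_of_le_of_ne hρ.1 hne1.symm)
      have hb : 0 < 5 - ρ := sub_pos.2 (lt_of_le_of_ne hρ.2 hne5)
      have hc : ρ - 3 ≠ 0 := sub_ne_zero.2 h3
      have hd : 0 < (ρ - 1) * (ρ - 3) ^ 2 * (5 - ρ) := by positivity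
      rw [P]
      linarith
    have hlt : ρ' < ρ := by
      have := mul_neg_of_pos_of_neg h1 hPneg
      linarith
    have hχ : chi ρ' ^ 2 < chi ρ ^ 2 := pow_lt_pow_left₀
      (chi_strictMono (Icc_subset_Ioo_domain hρ') (Icc_subset_Ioo_domain hρ) hlt)
      (by linarith) (by norm_num)
    have hη : eta ρ' ^ 2 < eta ρ ^ 2 := pow_lt_pow_left₀
      (eta_strictMono (Icc_subset_Ioo_domain hρ') (Icc_subset_Ioo_domain hρ) hlt)
      (by linarith) (by norm_num)
    have hc0 := sq_nonneg (Real.cos ϑ)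
    have hs0 := sq_nonneg (Real.sin ϑ)
    rcases hc0.lt_or_eq with hc1 | hc1
    · have := mul_lt_mul_of_pos_right hχ hc1
      have := mul_le_mul_of_nonneg_right hη.le hs0
      linarith
    · have hs1 : 0 < Real.sin ϑ ^ 2 := by linarith
      have := mul_lt_mul_of_pos_right hη hs1
      have := mul_le_mul_of_nonneg_right hχ.le hc0
      linarith

/-! ### The ellipse, its rotated image and their images under the maps -/

theorem rotation_image_ellipse :
    rotation '' ellipse = {p : annulus | (p : ℝ × ℝ).1 ^ 2 / 16 + (p : ℝ × ℝ).2 ^ 2 / 4 = 1} := by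
  rw [Equiv.image_eq_preimage_symm]
  ext p
  change (p : ℝ × ℝ).2 ^ 2 / 4 + (-(p : ℝ × ℝ).1) ^ 2 / 16 = 1 ↔
    (p : ℝ × ℝ).1 ^ 2 / 16 + (p : ℝ × ℝ).2 ^ 2 / 4 = 1
  rw [neg_sq, add_comm]

theorem rotation_image_rotation_image_ellipse : rotation '' (rotation '' ellipse) = ellipse := by
  rw [rotation_image_ellipse, Equiv.image_eq_preimage_symm]
  ext p
  change (p : ℝ × ℝ).2 ^ 2 / 16 + (-(p : ℝ × ℝ).1) ^ 2 / 4 = 1 ↔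
    (p : ℝ × ℝ).1 ^ 2 / 4 + (p : ℝ × ℝ).2 ^ 2 / 16 = 1
  rw [neg_sq, add_comm]

theorem rotation_image_ellipse_eq_ellipticPoint :
    rotation '' ellipse = {p : annulus | ∃ ϑ : ℝ, (p : ℝ × ℝ) = ellipticPoint (3, ϑ)} := by
  have hχ3 : chi 3 = 4 := by norm_num [chi]
  have hη3 : eta 3 = 2 := by norm_num [eta]
  rw [rotation_image_ellipse]
  ext p
  simp only [Set.mem_ofPred_eq, ellipticPoint, hχ3, hη3]
  constructor
  · intro h
    obtain ⟨ϑ, -, hc, hs⟩ := exists_cos_sin (c := (p : ℝ × ℝ).1 / 4) (s := (p : ℝ × ℝ).2 / 2)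
      (by rw [← h]; ring)
    refine ⟨ϑ, Prod.ext ?_ ?_⟩
    · simp only [← hc]; ring
    · simp only [← hs]; ring
  · rintro ⟨ϑ, h⟩
    rw [h]
    simp only [mul_pow]
    linarith [Real.cos_sq_add_sin_sq ϑ]

theorem shift_image_rotation_image_ellipse {ε : ℝ × ℝ} (hε : Admissible ε) :
    shiftPerm ε hε '' (rotation '' ellipse) = rotation '' ellipse := by
  have h3 : (3 : ℝ) ∈ Set.Icc (1 : ℝ) 5 := by norm_num
  have hfix : (3 : ℝ) + ε.1 * P 3 = 3 := by norm_num [P]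
  rw [rotation_image_ellipse_eq_ellipticPoint]
  ext p
  constructor
  · rintro ⟨q, ⟨ϑ, hq⟩, rfl⟩
    refine ⟨ϑ + ε.2 * Real.sin (2 * ϑ), (isEllipticShift_shiftPerm ε hε q 3 ϑ h3 hq).trans ?_⟩
    rw [hfix]
  · rintro ⟨ϑ, hp⟩
    obtain ⟨ψ, rfl⟩ := exists_shiftAngle_eq hε.2 ϑ
    refine ⟨⟨ellipticPoint (3, ψ), ellipticPoint_mem h3 ψ⟩, ⟨ψ, rfl⟩, Subtype.ext ?_⟩
    rw [hp, isEllipticShift_shiftPerm ε hε _ 3 ψ h3 rfl, hfix]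

theorem isEssentialCurve_ellipse_two_four : IsEssentialCurve ellipse := by
  have := isEssentialCurve_ellipse (a := 2) (b := 4) (by norm_num) (by norm_num)
  norm_num at this
  exact this

theorem isEssentialCurve_rotation_image_ellipse : IsEssentialCurve (rotation '' ellipse) := by
  have := isEssentialCurve_ellipse (a := 4) (b := 2) (by norm_num) (by norm_num)
  norm_num at this
  rw [rotation_image_ellipse]
  exact this

/-- `G⁻¹ K` is again essential, so it meets its rotated image; applying `G` gives the claim for `K`.
-/
theorem conjugate_hasIntersectionProperty {ε : ℝ × ℝ} (hε : Admissible ε) :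
    HasIntersectionProperty (shiftPerm ε hε * rotation * (shiftPerm ε hε)⁻¹ :
      Equiv.Perm annulus) := by
  intro K hK
  obtain ⟨_, ⟨y, ⟨k, hk, rfl⟩, rfl⟩, ⟨k', hk', hkk'⟩⟩ :=
    rotation_hasIntersectionProperty _ (hK.shift_inv_image hε)
  refine ⟨k', ⟨k, hk, ?_⟩, hk'⟩
  rw [Equiv.Perm.mul_apply, Equiv.Perm.mul_apply, ← hkk']
  exact (shiftPerm ε hε).apply_symm_apply k'

/-- The properties of the elliptic shift `G` and of the conjugated rotation `S`. -/
theorem elliptic_shift_properties (ε₁ ε₂ : ℝ) (h₁ : 0 < ε₁) (h₁' : ε₁ < 1 / 16) (h₂ : 0 < ε₂)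
    (h₂' : ε₂ < 1 / 2) :
    (∃! G : Equiv.Perm annulus, IsEllipticShift ε₁ ε₂ G) ∧
      ∀ G S : Equiv.Perm annulus, IsEllipticShift ε₁ ε₂ G → S = G * rotation * G⁻¹ →
        ∀ γ Rγ δ : Set annulus, γ = ellipse → Rγ = rotation '' γ → δ = G '' γ →
          IsAnalyticDiffeo G ∧ IsAnalyticDiffeo S ∧ HasIntersectionProperty S ∧
          ¬ HasIntersectionProperty (rotation * S) ∧
          IsEssentialCurve Rγ ∧ IsEssentialCurve δ ∧ G '' Rγ = Rγ ∧ StrictlyInside δ γ ∧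
          S '' Rγ = δ ∧ S '' δ = Rγ ∧ (rotation * S) '' Rγ = rotation '' δ ∧
          StrictlyInside ((rotation * S) '' Rγ) Rγ ∧ (rotation * S) '' δ = γ ∧
          StrictlyOutside γ δ := by
  have hε := admissible_of_lt h₁ h₁' h₂ h₂'
  have hshift := isEllipticShift_shiftPerm (ε₁, ε₂) hε
  refine ⟨⟨_, hshift, fun G hG => hG.eq hshift⟩, ?_⟩
  rintro G S hG rfl γ Rγ δ rfl rfl rfl
  obtain rfl : G = shiftPerm (ε₁, ε₂) hε := hG.eq hshift
  set G := shiftPerm (ε₁, ε₂) hε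
  set S := G * rotation * G⁻¹ with hS
  have hGd := isAnalyticDiffeo_shiftPerm _ hε
  have hfix : G '' (rotation '' ellipse) = rotation '' ellipse :=
    shift_image_rotation_image_ellipse hε
  have himg : ∀ K, S '' (G '' K) = G '' (rotation '' K) := fun K => by
    rw [hS, Set.image_image, Set.image_image]
    refine Set.image_congr fun x _ => ?_
    rw [Equiv.Perm.mul_apply, Equiv.Perm.mul_apply]
    exact congrArg (fun y => G (rotation y)) (G.symm_apply_apply x)
  have hmul : ∀ K, (rotation * S : Equiv.Perm annulus) '' K = rotation '' (S '' K) := fun K => by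
    rw [Equiv.Perm.coe_mul, Set.image_comp]
  -- Invariance of `Rγ` under `G` lets it be written as `G(Rγ)`, on which `S` acts as `G R`.
  have hS1 : S '' (rotation '' ellipse) = G '' ellipse := by
    rw [← hfix, himg, rotation_image_rotation_image_ellipse]
  have hS2 : S '' (G '' ellipse) = rotation '' ellipse := by
    rw [himg, hfix]
  have hδ : ∀ p ∈ G '' ellipse, (p : ℝ × ℝ).1 ^ 2 / 4 + (p : ℝ × ℝ).2 ^ 2 / 16 < 1 := by
    rintro _ ⟨p, hp, rfl⟩
    exact shift_gauge_lt hε h₁ h₂ hp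
  have hin : StrictlyInside ((rotation * S : Equiv.Perm annulus) '' (rotation '' ellipse))
      (rotation '' ellipse) := by
    rw [hmul, hS1, rotation_image_ellipse]
    refine strictlyInside_of_gauge_lt (by norm_num) (by norm_num) ?_
    rintro _ ⟨p, hp, rfl⟩
    have := hδ p hp
    change (-(p : ℝ × ℝ).2) ^ 2 / 16 + (p : ℝ × ℝ).1 ^ 2 / 4 < 1
    rw [neg_sq]
    linarith
  refine ⟨hGd, (hGd.mul isAnalyticDiffeo_rotation).mul hGd.inv,
    conjugate_hasIntersectionProperty hε, fun hIP => ?_, isEssentialCurve_rotation_image_ellipse,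
    isEssentialCurve_ellipse_two_four.shift_image hε, hfix,
    strictlyInside_of_gauge_lt (by norm_num) (by norm_num) hδ, hS1, hS2, by rw [hmul, hS1],
    hin, by rw [hmul, hS2, rotation_image_rotation_image_ellipse],
    strictlyOutside_of_gauge_lt (fun p hp => ?_) hδ⟩
  · obtain ⟨x, hx, hxK⟩ := hIP _ isEssentialCurve_rotation_image_ellipse
    exact (hin x hx).1 hxK
  · have h : (p : ℝ × ℝ).1 ^ 2 / 4 + (p : ℝ × ℝ).2 ^ 2 / 16 = 1 := hp
    exact h.ge

theorem mem_annulus_of_ellipse {p : ℝ × ℝ} (h : p.1 ^ 2 / 16 + p.2 ^ 2 / 4 = 1) :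
    p ∈ annulus := by
  constructor <;> linarith [sq_nonneg p.1, sq_nonneg p.2]

end

end AnnulusExample

open AnnulusExample in
theorem mainTheorem1 :
    -- the elliptic coordinates `(ρ, ϑ mod 2π)` are well defined analytic coordinates
    Set.BijOn AnnulusExample.ellipticPoint (Set.Icc 1 5 ×ˢ Set.Ico 0 (2 * Real.pi))
        AnnulusExample.annulus ∧
    (∀ ρ ∈ Set.Icc (1 : ℝ) 5, ∀ ϑ : ℝ,
      AnalyticAt ℝ AnnulusExample.ellipticPoint (ρ, ϑ) ∧
      Function.Bijective (fderiv ℝ AnnulusExample.ellipticPoint (ρ, ϑ))) ∧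
    -- the rotation
    AnnulusExample.IsAnalyticDiffeo AnnulusExample.rotation ∧
    AnnulusExample.HasIntersectionProperty AnnulusExample.rotation ∧
    -- the image of the ellipse under the rotation
    AnnulusExample.rotation '' AnnulusExample.ellipse =
      {p | (p : ℝ × ℝ).1 ^ 2 / 16 + (p : ℝ × ℝ).2 ^ 2 / 4 = 1} ∧
    AnnulusExample.rotation '' AnnulusExample.ellipse =
      {p | ∃ ϑ : ℝ, (p : ℝ × ℝ) = AnnulusExample.ellipticPoint (3, ϑ)} ∧
    -- the maps `G` and `S = G R G⁻¹` for all admissible parameters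
    (∀ ε₁ ε₂ : ℝ, 0 < ε₁ → ε₁ < 1 / 16 → 0 < ε₂ → ε₂ < 1 / 2 →
      (∃! G : Equiv.Perm AnnulusExample.annulus, AnnulusExample.IsEllipticShift ε₁ ε₂ G) ∧
      ∀ G S : Equiv.Perm AnnulusExample.annulus, AnnulusExample.IsEllipticShift ε₁ ε₂ G →
        S = G * AnnulusExample.rotation * G⁻¹ →
        ∀ γ Rγ δ : Set AnnulusExample.annulus, γ = AnnulusExample.ellipse →
          Rγ = AnnulusExample.rotation '' γ → δ = G '' γ →
          AnnulusExample.IsAnalyticDiffeo G ∧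
          AnnulusExample.IsAnalyticDiffeo S ∧
          AnnulusExample.HasIntersectionProperty S ∧
          ¬ AnnulusExample.HasIntersectionProperty (AnnulusExample.rotation * S) ∧
          AnnulusExample.IsEssentialCurve Rγ ∧
          AnnulusExample.IsEssentialCurve δ ∧
          G '' Rγ = Rγ ∧
          AnnulusExample.StrictlyInside δ γ ∧
          S '' Rγ = δ ∧
          S '' δ = Rγ ∧
          (AnnulusExample.rotation * S) '' Rγ = AnnulusExample.rotation '' δ ∧
          AnnulusExample.StrictlyInside ((AnnulusExample.rotation * S) '' Rγ) Rγ ∧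
          (AnnulusExample.rotation * S) '' δ = γ ∧
          AnnulusExample.StrictlyOutside γ δ) ∧
    -- `G` is arbitrarily close to the identity and `S` is arbitrarily close to the rotation
    (∀ (k : ℕ) (r : ℝ), 0 < r → ∃ ε₀ : ℝ, 0 < ε₀ ∧
      ∀ ε₁ ε₂ : ℝ, 0 < ε₁ → ε₁ < 1 / 16 → 0 < ε₂ → ε₂ < 1 / 2 → ε₁ < ε₀ → ε₂ < ε₀ →
        ∀ G : Equiv.Perm AnnulusExample.annulus, AnnulusExample.IsEllipticShift ε₁ ε₂ G →
          AnnulusExample.CkClose k r G id ∧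
          AnnulusExample.CkClose k r (G * AnnulusExample.rotation * G⁻¹)
            AnnulusExample.rotation) := by
  refine ⟨bijOn_ellipticPoint, fun ρ hρ ϑ => ⟨analyticAt_ellipticPoint hρ ϑ,
    bijective_fderiv_ellipticPoint hρ ϑ⟩, isAnalyticDiffeo_rotation,
    rotation_hasIntersectionProperty, ?_, ?_, elliptic_shift_properties, ?_⟩
  -- The two sides are sets in the plane, the left one an image under the inclusion, so the full
  -- ellipse must be shown to lie in the annulus.
  · rw [rotation_image_ellipse]
    ext p
    exact ⟨fun ⟨q, hq, hqp⟩ => hqp ▸ hq, fun h => ⟨⟨p, mem_annulus_of_ellipse h⟩, h, rfl⟩⟩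
  · rw [rotation_image_ellipse_eq_ellipticPoint]
    ext p
    exact ⟨fun ⟨q, hq, hqp⟩ => hqp ▸ hq, fun ⟨ϑ, h⟩ => ⟨⟨p, h ▸ ellipticPoint_mem
      (by norm_num) ϑ⟩, ⟨ϑ, h⟩, rfl⟩⟩
  · intro k r hr
    obtain ⟨ε₀, hε₀, h⟩ := exists_ckClose k hr
    refine ⟨ε₀, hε₀, fun ε₁ ε₂ h₁ h₁' h₂ h₂' hlt₁ hlt₂ G hG => ?_⟩
    have hε := admissible_of_lt h₁ h₁' h₂ h₂'
    obtain rfl := hG.eq (isEllipticShift_shiftPerm (ε₁, ε₂) hε)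
    exact h (ε₁, ε₂) (by rwa [abs_of_pos h₁]) (by rwa [abs_of_pos h₂]) hε
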